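/- **Setting.** Let $n\in\mathbb N$, $T>0$, $1<\alpha\le 2$, and let $\phi\in C^1[0,T]$ with $\phi'>0$ on $[0,T]$. Put $\delta f=\frac{1}{\phi'}\frac{d}{dt}f$ on $[0,T]$ (one-sided at the end points), $I_{0+}^{0,\phi}f=f$, and $$I_{0+}^{\mu,\phi}f(t)=\frac1{\Gamma(\mu)}\int_0^t\phi'(s)(\phi(t)-\phi(s))^{\mu-1}f(s)\,ds\quad(\mu>0),\qquad D_{0+}^{\alpha,\phi}f=\delta^{2}\,I_{0+}^{2-\alpha,\phi}f,$$ $${}^{C}D_{0+}^{\alpha,\phi}f=D_{0+}^{\alpha,\phi}\big[f-f(0)-(\delta f)(0)\,(\phi-\phi(0))\big].$$ Let $\Theta$ be continuous and positive on $[0,T]$. The inverse problem for the wave-type operator $\Theta^{1/2}(t)D_x+\mathfrak f\,{}^C\partial_t^{\alpha,\phi}+\mathfrak f^+$ ($D_x$ the Euclidean Dirac operator, $\mathfrak f,\mathfrak f^+$ the Witt basis elements) is posed through the scalar equation $\big(-\Theta(t)\Delta_x+{}^C\partial_t^{\alpha,\phi}\big)u=0$ that results from it by formally applying the operator once more. For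 a continuous, compactly supported $g:\mathbb R^n\to\mathbb C$, a *solution* of the Cauchy problem with datum $g$, $${}^{C}\partial_t^{\alpha,\phi}u(x,t)-\Theta(t)\Delta_xu(x,t)=0\ \ (x\in\mathbb R^n,\ 0<t\le T),\qquad u|_{t=0}=0,\qquad \tfrac{1}{\phi'}\partial_tu\big|_{t=0}=g ,$$ is a continuous function $u:\mathbb R^n\times[0,T]\to\mathbb C$ with $u(\cdot,0)=0$ and $\sup_{0\le t\le T}\|u(\cdot,t)\|_{L^1(\mathbb R^n)}<\infty$ such that, for every $\psi\in C_c^\infty(\mathbb R^n)$, the function $U_\psi(t)=\int u(x,t)\psi(x)\,dx$ is in $C^1[0,T]$, $(\delta U_\psi)(0)=\int g\psi\,dx$, and for every $t\in(0,T]$ the derivative ${}^CD_{0+}^{\alpha,\phi}U_\psi(t)$ exists and equals $\Theta(t)\int u(x,t)\,\Delta\psi(x)\,dx$. Let $\Omega\subset\mathbb R^n$ be open and bounded, $q\in\Omega$, let $w$ and $v$ be solutions with data $w_1$ and $\Delta w_1$ respectively, where $w_1$ is extended by $0$ outside $\Omega$, and for $0\le t\le T$ let $$h_1(t)=w(q,t)-w_1(q)\,(\phi(t)-\phi(0)),\qquad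 h_2(t)=v(q,t).$$ **Theorem.** Assume that 1. $\|\Theta\|_{\max}\,I_{0+}^{\alpha,\phi}e^{\nu t}\le Ce^{\nu t}$ on $[0,T]$ for some $\nu>0$ and some constant $0<C<1$ independent of $t$; 2. $w_1\in C^2(\Omega)\cap C^1(\overline\Omega)$ and $\operatorname{supp}w_1\subset\Omega$; 3. $h_2\in C^2[0,T]$ and $h_2(t)\ne0$ for every $t\in(0,T)$; 4. $\dfrac{D_{0+}^{\alpha,\phi}h_1(t)}{h_2(t)}\ge K>0$ for every $t\in(0,T]$ (in particular the quotient is real, and $h_2(T)\neq0$). Then $D_{0+}^{\alpha,\phi}h_1$ exists on $(0,T]$, and the coefficient is recovered from the data by $$\Theta(t)=\frac{D_{0+}^{\alpha,\phi}h_1(t)}{h_2(t)},\qquad t\in(0,T].$$ -/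

import Mathlib

open Set MeasureTheory
open scoped ContDiff Laplacian ComplexOrder

namespace FractionalWave

noncomputable section

/-- The derivative `(1 / φ'(t)) (d/dt) f(t)` on `[0, T]`. At the end points `0` and `T` the
derivatives are one-sided. -/
def phiDeriv {F : Type*} [NormedAddCommGroup F] [NormedSpace ℝ F]
    (T : ℝ) (φ : ℝ → ℝ) (f : ℝ → F) (t : ℝ) : F :=
  (derivWithin φ (Icc 0 T) t)⁻¹ • derivWithin f (Icc 0 T) t

/-- The left-sided Riemann-Liouville fractional integral `I_{0+}^{μ,φ} f` of real order `μ ≥ 0`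
with respect to `φ`; `I_{0+}^{0,φ}` is the identity. -/
def rlIntegral {F : Type*} [NormedAddCommGroup F] [NormedSpace ℝ F]
    (T : ℝ) (φ : ℝ → ℝ) (μ : ℝ) (f : ℝ → F) (t : ℝ) : F :=
  if μ = 0 then f t else
    (Real.Gamma μ)⁻¹ •
      ∫ s in (0 : ℝ)..t, (derivWithin φ (Icc 0 T) s * (φ t - φ s) ^ (μ - 1)) • f s

/-- The left-sided Riemann-Liouville fractional derivative
`D_{0+}^{α,φ} f = ((1 / φ') d/dt)^m I_{0+}^{m-α,φ} f`, `m = ⌈α⌉`. -/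
def rlDeriv {F : Type*} [NormedAddCommGroup F] [NormedSpace ℝ F]
    (T : ℝ) (φ : ℝ → ℝ) (α : ℝ) (f : ℝ → F) : ℝ → F :=
  (phiDeriv T φ)^[⌈α⌉₊] (rlIntegral T φ (⌈α⌉₊ - α) f)

/-- `D_{0+}^{α,φ} f` exists on `(0, T]`: each of the `m` successive derivatives that make up
`((1 / φ') d/dt)^m I_{0+}^{m-α,φ} f` exists at every point of `(0, T]`. -/
def RLDifferentiable {F : Type*} [NormedAddCommGroup F] [NormedSpace ℝ F]
    (T : ℝ) (φ : ℝ → ℝ) (α : ℝ) (f : ℝ → F) : Prop :=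
  ∀ k < ⌈α⌉₊, ∀ t ∈ Ioc 0 T, DifferentiableWithinAt ℝ
    ((phiDeriv T φ)^[k] (rlIntegral T φ (⌈α⌉₊ - α) f)) (Icc 0 T) t

/-- `f` minus its Taylor polynomial in powers of `φ(t) - φ(0)`, of degree `⌈α⌉ - 1`. -/
def taylorRemainder {F : Type*} [NormedAddCommGroup F] [NormedSpace ℝ F]
    (T : ℝ) (φ : ℝ → ℝ) (α : ℝ) (f : ℝ → F) (t : ℝ) : F :=
  f t - ∑ j ∈ Finset.range ⌈α⌉₊,
    ((φ t - φ 0) ^ j / (Nat.factorial j : ℝ)) • (phiDeriv T φ)^[j] f 0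

/-- The modified (Caputo type) fractional derivative `^C D_{0+}^{α,φ} f`. -/
def caputoDeriv {F : Type*} [NormedAddCommGroup F] [NormedSpace ℝ F]
    (T : ℝ) (φ : ℝ → ℝ) (α : ℝ) (f : ℝ → F) : ℝ → F :=
  rlDeriv T φ α (taylorRemainder T φ α f)

/-- The `x`-weak pairing `t ↦ ∫ ψ(x) w(x,t) dx`. -/
def pairing {n : ℕ} (ψ : EuclideanSpace ℝ (Fin n) → ℝ)
    (w : EuclideanSpace ℝ (Fin n) → ℝ → ℂ) (t : ℝ) : ℂ :=
  ∫ x, ψ x • w x t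

/-- `w` is a solution on `ℝⁿ × [0, T]` of the Cauchy problem

  `^C∂_t^{α,φ} w - Θ(t) Δ_x w = 0` on `ℝⁿ × (0, T]`, `w|_{t=0} = 0`,
  `((1 / φ') ∂_t w)|_{t=0} = g`,

for `1 < α ≤ 2`. The space variable is treated in the sense of distributions, i.e. after testing
with an arbitrary `ψ ∈ C_c^∞(ℝⁿ)`; in time the equation holds pointwise. The solution is jointly
continuous, and it belongs to `L¹(ℝⁿ)` in `x`, boundedly in `t`, so that it has a Fourier
transform in `x`. -/
structure IsSolution {n : ℕ} (T : ℝ) (φ : ℝ → ℝ) (α : ℝ) (Θ : ℝ → ℝ)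
    (g : EuclideanSpace ℝ (Fin n) → ℂ) (w : EuclideanSpace ℝ (Fin n) → ℝ → ℂ) : Prop where
  continuousOn : ContinuousOn (fun p : EuclideanSpace ℝ (Fin n) × ℝ => w p.1 p.2)
    (univ ×ˢ Icc 0 T)
  bounded_L1 : ∃ M : ℝ, ∀ t ∈ Icc 0 T,
    Integrable (fun x => w x t) ∧ ∫ x, ‖w x t‖ ≤ M
  initial : ∀ x, w x 0 = 0
  contDiffOn : ∀ ψ : EuclideanSpace ℝ (Fin n) → ℝ, ContDiff ℝ ∞ ψ → HasCompactSupport ψ →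
    ContDiffOn ℝ 1 (pairing ψ w) (Icc 0 T)
  initial_deriv : ∀ ψ : EuclideanSpace ℝ (Fin n) → ℝ, ContDiff ℝ ∞ ψ → HasCompactSupport ψ →
    phiDeriv T φ (pairing ψ w) 0 = ∫ x, ψ x • g x
  caputo_exists : ∀ ψ : EuclideanSpace ℝ (Fin n) → ℝ, ContDiff ℝ ∞ ψ → HasCompactSupport ψ →
    RLDifferentiable T φ α (taylorRemainder T φ α (pairing ψ w))
  equation : ∀ ψ : EuclideanSpace ℝ (Fin n) → ℝ, ContDiff ℝ ∞ ψ → HasCompactSupport ψ →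
    ∀ t ∈ Ioc 0 T,
      caputoDeriv T φ α (pairing ψ w) t - Θ t • pairing (Δ ψ) w t = 0

end

end FractionalWave

/-! The heart is the identity `v = Δw`: the datum of `v` is the Laplacian of the datum of `w`, and
the coefficient `Θ` depends on time only. Granted it, the equation for `w` at `q` reads `h₁ = I^α(Θ
h₂)`; applying `D^α` gives `D^α h₁ = Θ h₂`, and one divides by `h₂`. In time, the law `I^a I^b =
I^(a+b)` and the fundamental theorem for `I^1` turn the Caputo equation into a Volterra equation
(`IsTimeChange.eq_of_caputoDeriv_eq`) and invert `I^α`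
(`IsTimeChange.rlDifferentiable_and_rlDeriv_eq`). In space, `w` and `v` are only weak solutions, so
`v = Δw` is proved on the Fourier side. Uniform `L¹` bounds allow testing with plane waves `e`,
where `Δe = -‖a‖² e`. Then `‖a‖²⟨e, w⟩ + ⟨e, v⟩` is a bounded solution of a homogeneous Volterra
equation, hence zero (`IsTimeChange.eq_zero_of_eq_rlIntegral`), and Fourier inversion of test
functions yields `⟨Δψ, w⟩ = ⟨ψ, v⟩`. Letting `ψ` concentrate at `q` gives the pointwise equation
(`IsSolution.apply_eq`). -/

namespace FractionalWave

/-! ### Semigroup law for fractional integrals and the change of time -/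

noncomputable section

/-- The Riemann-Liouville integral with respect to the identity function. -/
def fracIntegral {F : Type*} [NormedAddCommGroup F] [NormedSpace ℝ F]
    (μ : ℝ) (f : ℝ → F) (y : ℝ) : F :=
  (Real.Gamma μ)⁻¹ • ∫ r in (0 : ℝ)..y, (y - r) ^ (μ - 1) • f r

variable {E : Type*} [NormedAddCommGroup E] [NormedSpace ℝ E]

/-- Euler's Beta integral, rescaled and expressed through Gamma. Both bases are nonnegative on the
interval, so complex and real powers agree there. -/
lemma integral_rpow_mul_sub_rpow {a b x : ℝ} (ha : 0 < a) (hb : 0 < b) (hx : 0 < x) :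
    ∫ r in (0 : ℝ)..x, r ^ (b - 1) * (x - r) ^ (a - 1) =
      Real.Gamma a * Real.Gamma b / Real.Gamma (a + b) * x ^ (a + b - 1) := by
  have h := Complex.betaIntegral_scaled (b : ℂ) (a : ℂ) hx
  have h2 := Complex.Gamma_mul_Gamma_eq_betaIntegral (s := (b : ℂ)) (t := (a : ℂ))
    (by simpa using hb) (by simpa using ha)
  have hG : Real.Gamma (a + b) ≠ 0 := (Real.Gamma_pos_of_pos (by linarith)).ne'
  rw [← Complex.ofReal_inj, ← intervalIntegral.integral_ofReal]
  have e : ∫ r in (0 : ℝ)..x, ((r ^ (b - 1) * (x - r) ^ (a - 1) : ℝ) : ℂ) =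
      ∫ r in (0 : ℝ)..x, (r : ℂ) ^ ((b : ℂ) - 1) * ((x : ℂ) - r) ^ ((a : ℂ) - 1) := by
    apply intervalIntegral.integral_congr
    intro r hr
    rw [uIcc_of_le hx.le] at hr
    simp only
    rw [Complex.ofReal_mul, Complex.ofReal_cpow hr.1, Complex.ofReal_cpow (sub_nonneg.2 hr.2)]
    push_cast
    rfl
  rw [e, h]
  rw [← Complex.ofReal_add, Complex.Gamma_ofReal, Complex.Gamma_ofReal, Complex.Gamma_ofReal] at h2
  have h3 : Complex.betaIntegral b a =
      ((Real.Gamma a * Real.Gamma b / Real.Gamma (a + b) : ℝ) : ℂ) := by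
    rw [add_comm b a] at h2
    have : ((Real.Gamma (a + b) : ℝ) : ℂ) ≠ 0 := by exact_mod_cast hG
    push_cast
    rw [eq_div_iff this, mul_comm, ← h2, mul_comm]
  rw [h3, Complex.ofReal_mul, Complex.ofReal_cpow hx.le]
  push_cast
  rw [mul_comm, add_comm (a : ℂ)]

lemma integral_sub_rpow_mul_sub_rpow {a b s y : ℝ} (ha : 0 < a) (hb : 0 < b) (hx : s < y) :
    ∫ r in s..y, (y - r) ^ (a - 1) * (r - s) ^ (b - 1) =
      Real.Gamma a * Real.Gamma b / Real.Gamma (a + b) * (y - s) ^ (a + b - 1) := by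
  rw [← integral_rpow_mul_sub_rpow ha hb (sub_pos.2 hx)]
  have := intervalIntegral.integral_comp_sub_right (a := s) (b := y)
    (fun r : ℝ => r ^ (b - 1) * (y - s - r) ^ (a - 1)) s
  rw [sub_self] at this
  rw [← this]
  congr 1 with r
  rw [mul_comm]
  congr 2
  ring

lemma integrable_indicator_rpow {a y : ℝ} (ha : 0 < a) :
    Integrable ((Ioo 0 y).indicator fun x : ℝ => x ^ (a - 1)) := by
  rw [integrable_indicator_iff measurableSet_Ioo]
  rcases le_or_gt y 0 with h | h
  · simp [Ioo_eq_empty_of_le h]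
  · exact (intervalIntegrable_iff_integrableOn_Ioo_of_le h.le).1
      (intervalIntegral.intervalIntegrable_rpow' (by linarith))

/-- Fubini on the triangle `0 < s < r < y`: integrating out `r` first leaves a Beta integral, whose
Gamma factors produce the normalisation of order `a + b`. -/
lemma fracIntegral_fracIntegral [CompleteSpace E] {a b y : ℝ} (ha : 0 < a) (hb : 0 < b) (hy : 0 ≤ y)
    {f : ℝ → E} (hf : Continuous f) :
    fracIntegral a (fracIntegral b f) y = fracIntegral (a + b) f y := by
  rcases hy.eq_or_lt with rfl | hy
  · simp [fracIntegral]
  -- Kernels cut off to `(0, y)` are integrable on the whole line, so their product in `(s, r)` is a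
  -- convolution integrand, integrable on the plane. Together with the cutoff of `f`, they encode
  -- the triangle.
  set k : ℝ → ℝ → ℝ := fun c => (Ioo 0 y).indicator fun x : ℝ => x ^ (c - 1) with hk
  obtain ⟨M, hM⟩ := isCompact_Icc.exists_bound_of_continuousOn (s := Icc 0 y) hf.continuousOn
  have hint : Integrable (fun p : ℝ × ℝ =>
      (k a (y - p.2) * k b (p.2 - p.1)) • (Ioo 0 y).indicator f p.1) (volume.prod volume) := by
    have h1 : Integrable (fun p : ℝ × ℝ => k a (y - p.2) * k b (p.2 - p.1))
        (volume.prod volume) := by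
      have := Integrable.convolution_integrand (ContinuousLinearMap.mul ℝ ℝ)
        ((integrable_indicator_rpow (y := y) ha).comp_sub_left y)
        ((integrable_indicator_rpow (y := y) hb).comp_neg)
      simpa [hk] using this
    refine h1.smul_bdd M ?_ (.of_forall fun p => ?_)
    · exact ((hf.stronglyMeasurable.indicator measurableSet_Ioo).comp_measurable
        measurable_fst).aestronglyMeasurable
    · by_cases hp : p.1 ∈ Ioo 0 y
      · rw [indicator_of_mem hp]
        exact hM _ (Ioo_subset_Icc_self hp)
      · rw [indicator_of_notMem hp, norm_zero]
        exact (norm_nonneg _).trans (hM 0 ⟨le_rfl, hy.le⟩)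
  have hswap := integral_integral_swap (f := fun s r =>
    (k a (y - r) * k b (r - s)) • (Ioo 0 y).indicator f s) hint
  have hl : ∫ r, ∫ s, (k a (y - r) * k b (r - s)) • (Ioo 0 y).indicator f s =
      ∫ r in (0 : ℝ)..y, (y - r) ^ (a - 1) • ∫ s in (0 : ℝ)..r, (r - s) ^ (b - 1) • f s := by
    rw [intervalIntegral.integral_of_le hy.le, integral_Ioc_eq_integral_Ioo,
      ← integral_indicator measurableSet_Ioo]
    congr 1 with r
    by_cases hr : r ∈ Ioo 0 y
    · rw [indicator_of_mem hr, intervalIntegral.integral_of_le hr.1.le,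
        integral_Ioc_eq_integral_Ioo, ← integral_smul, ← integral_indicator measurableSet_Ioo]
      congr 1 with s
      by_cases hs : s ∈ Ioo 0 r
      · have h1 : y - r ∈ Ioo 0 y := ⟨by linarith [hr.2], by linarith [hr.1]⟩
        have h2 : r - s ∈ Ioo 0 y := ⟨by linarith [hs.2], by linarith [hr.2, hs.1]⟩
        have h3 : s ∈ Ioo 0 y := ⟨hs.1, hs.2.trans hr.2⟩
        simp only [hk]
        rw [indicator_of_mem h1, indicator_of_mem h2, indicator_of_mem h3, indicator_of_mem hs,
          mul_smul]
      · rw [indicator_of_notMem hs]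
        by_cases h3 : s ∈ Ioo 0 y
        · have h2 : r - s ∉ Ioo 0 y := fun h => hs ⟨h3.1, by linarith [h.1]⟩
          simp only [hk]
          rw [indicator_of_notMem h2, mul_zero, zero_smul]
        · rw [indicator_of_notMem h3, smul_zero]
    · have h1 : y - r ∉ Ioo 0 y := fun h => hr ⟨by linarith [h.2], by linarith [h.1]⟩
      rw [indicator_of_notMem hr]
      simp only [hk]
      simp [indicator_of_notMem h1]
  have hr : ∫ s, ∫ r, (k a (y - r) * k b (r - s)) • (Ioo 0 y).indicator f s =
      ∫ s in (0 : ℝ)..y, (Real.Gamma a * Real.Gamma b / Real.Gamma (a + b) *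
        (y - s) ^ (a + b - 1)) • f s := by
    rw [intervalIntegral.integral_of_le hy.le, integral_Ioc_eq_integral_Ioo,
      ← integral_indicator measurableSet_Ioo]
    congr 1 with s
    by_cases hs : s ∈ Ioo 0 y
    · rw [integral_smul_const, indicator_of_mem hs, indicator_of_mem hs,
        ← integral_sub_rpow_mul_sub_rpow ha hb hs.2, intervalIntegral.integral_of_le hs.2.le,
        integral_Ioc_eq_integral_Ioo, ← integral_indicator measurableSet_Ioo]
      congr 2 with r
      by_cases hr : r ∈ Ioo s y
      · have h1 : y - r ∈ Ioo 0 y := ⟨by linarith [hr.2], by linarith [hr.1, hs.1]⟩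
        have h2 : r - s ∈ Ioo 0 y := ⟨by linarith [hr.1], by linarith [hr.2, hs.1]⟩
        simp only [hk]
        rw [indicator_of_mem h1, indicator_of_mem h2, indicator_of_mem hr]
      · rw [indicator_of_notMem hr]
        simp only [hk]
        by_cases h1 : y - r ∈ Ioo 0 y
        · have h2 : r - s ∉ Ioo 0 y := fun h => hr ⟨by linarith [h.1], by linarith [h1.1]⟩
          rw [indicator_of_notMem h2, mul_zero]
        · rw [indicator_of_notMem h1, zero_mul]
    · simp [indicator_of_notMem hs]
  rw [hr, hl] at hswap
  have hGa := (Real.Gamma_pos_of_pos ha).ne'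
  have hGb := (Real.Gamma_pos_of_pos hb).ne'
  have e1 : ∀ r, (y - r) ^ (a - 1) • fracIntegral b f r =
      (Real.Gamma b)⁻¹ • ((y - r) ^ (a - 1) • ∫ s in (0 : ℝ)..r, (r - s) ^ (b - 1) • f s) :=
    fun r => smul_comm _ _ _
  have e2 : ∀ s, (Real.Gamma a * Real.Gamma b / Real.Gamma (a + b) *
      (y - s) ^ (a + b - 1)) • f s = (Real.Gamma a * Real.Gamma b / Real.Gamma (a + b)) •
        ((y - s) ^ (a + b - 1) • f s) := fun s => mul_smul _ _ _
  simp only [e2, intervalIntegral.integral_smul] at hswap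
  rw [fracIntegral]
  simp only [e1, intervalIntegral.integral_smul]
  rw [← hswap, fracIntegral, smul_smul, smul_smul]
  congr 1
  field_simp

/-- The substitution `r = y u` frees the singular kernel of `y`; dominated convergence with majorant
`(1 - u)^(b - 1) M` then applies. -/
lemma continuousOn_fracIntegral {b : ℝ} (hb : 0 < b) {f : ℝ → E} (hf : Continuous f)
    (hfb : ∃ M, ∀ y, ‖f y‖ ≤ M) : ContinuousOn (fracIntegral b f) (Ici 0) := by
  obtain ⟨M, hM⟩ := hfb
  have hscale : ∀ y ∈ Ici (0 : ℝ), fracIntegral b f y =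
      (Real.Gamma b)⁻¹ • y ^ b • ∫ u in Ioc (0 : ℝ) 1, (1 - u) ^ (b - 1) • f (y * u) := by
    intro y hy
    rcases (mem_Ici.1 hy).eq_or_lt with rfl | hy
    · simp [fracIntegral, Real.zero_rpow hb.ne']
    rw [fracIntegral, ← intervalIntegral.integral_of_le zero_le_one]
    congr 1
    have h := intervalIntegral.smul_integral_comp_mul_left (a := 0) (b := 1)
      (f := fun r => (y - r) ^ (b - 1) • f r) y
    rw [mul_zero, mul_one] at h
    rw [← h, ← intervalIntegral.integral_smul, ← intervalIntegral.integral_smul]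
    apply intervalIntegral.integral_congr
    intro u hu
    rw [uIcc_of_le zero_le_one] at hu
    simp only
    rw [smul_smul, smul_smul, show y - y * u = y * (1 - u) by ring,
      Real.mul_rpow hy.le (sub_nonneg.2 hu.2), ← mul_assoc]
    congr 2
    rw [← Real.rpow_one_add' hy.le (by linarith)]
    congr 1
    ring
  refine ContinuousOn.congr ?_ hscale
  refine (continuousOn_id.rpow_const fun _ _ => Or.inr hb.le).smul ?_ |>.const_smul _
  have hk : IntegrableOn (fun u : ℝ => (1 - u) ^ (b - 1)) (Ioc 0 1) := by
    have := intervalIntegral.intervalIntegrable_rpow' (a := 1) (b := 0) (r := b - 1) (by linarith)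
    have := this.comp_sub_left 1
    simpa [intervalIntegrable_iff_integrableOn_Ioc_of_le] using this
  refine (continuous_of_dominated (bound := fun u => ‖(1 - u) ^ (b - 1)‖ * M)
    (fun y => ?_) (fun y => ?_) (hk.norm.mul_const M) ?_).continuousOn
  · exact hk.aestronglyMeasurable.smul (hf.comp (by fun_prop)).aestronglyMeasurable
  · refine Filter.Eventually.of_forall fun u => ?_
    rw [norm_smul]
    exact mul_le_mul_of_nonneg_left (hM _) (norm_nonneg _)
  · exact Filter.Eventually.of_forall fun u => (hf.comp (by fun_prop)).const_smul _

/-- `φ` is continuously differentiable on `[0, T]` with positive derivative. -/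
structure IsTimeChange (T : ℝ) (φ : ℝ → ℝ) : Prop where
  pos : 0 < T
  contDiffOn : ContDiffOn ℝ 1 φ (Icc 0 T)
  deriv_pos : ∀ t ∈ Icc 0 T, 0 < derivWithin φ (Icc 0 T) t

namespace IsTimeChange

variable {T : ℝ} {φ : ℝ → ℝ}

lemma uniqueDiffOn (h : IsTimeChange T φ) : UniqueDiffOn ℝ (Icc 0 T) := uniqueDiffOn_Icc h.pos

lemma continuousOn_derivWithin (h : IsTimeChange T φ) :
    ContinuousOn (derivWithin φ (Icc 0 T)) (Icc 0 T) :=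
  h.contDiffOn.continuousOn_derivWithin h.uniqueDiffOn le_rfl

lemma hasDerivWithinAt (h : IsTimeChange T φ) {t : ℝ} (ht : t ∈ Icc 0 T) :
    HasDerivWithinAt φ (derivWithin φ (Icc 0 T) t) (Icc 0 T) t :=
  (h.contDiffOn.differentiableOn one_ne_zero t ht).hasDerivWithinAt

lemma strictMonoOn (h : IsTimeChange T φ) : StrictMonoOn φ (Icc 0 T) := by
  refine strictMonoOn_of_deriv_pos (convex_Icc 0 T) h.contDiffOn.continuousOn fun t ht => ?_
  rw [interior_Icc] at ht
  rw [← derivWithin_of_mem_nhds (Icc_mem_nhds ht.1 ht.2)]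
  exact h.deriv_pos t (Ioo_subset_Icc_self ht)

lemma image_Icc (h : IsTimeChange T φ) {t : ℝ} (ht : t ∈ Icc 0 T) :
    φ '' Icc 0 t = Icc (φ 0) (φ t) := by
  have hs : Icc 0 t ⊆ Icc 0 T := Icc_subset_Icc_right ht.2
  refine Subset.antisymm ?_ (intermediate_value_Icc ht.1 (h.contDiffOn.continuousOn.mono hs))
  rintro _ ⟨s, hs', rfl⟩
  exact ⟨h.strictMonoOn.monotoneOn ⟨le_rfl, h.pos.le⟩ (hs hs') hs'.1,
    h.strictMonoOn.monotoneOn (hs hs') ht hs'.2⟩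

/-- Clamping to the range of `φ` extends the inverse to all of `ℝ`, so that `f ∘ g` is globally
continuous and bounded as soon as `f` is continuous on `[0, T]`. -/
lemma exists_inverse (h : IsTimeChange T φ) : ∃ g : ℝ → ℝ, Continuous g ∧
    (∀ y, g y ∈ Icc 0 T) ∧ ∀ t ∈ Icc 0 T, g (φ t - φ 0) = t := by
  have h0 : (0 : ℝ) ∈ Icc 0 T := ⟨le_rfl, h.pos.le⟩
  have hT : T ∈ Icc 0 T := ⟨h.pos.le, le_rfl⟩
  have hle : φ 0 ≤ φ T := h.strictMonoOn.monotoneOn h0 hT h.pos.le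
  let e : Icc 0 T ≃o Icc (φ 0) (φ T) :=
    (h.strictMonoOn.orderIso φ (Icc 0 T)).trans (OrderIso.setCongr _ _ (h.image_Icc hT))
  refine ⟨fun y => e.symm (projIcc _ _ hle (y + φ 0)), ?_, fun y => Subtype.coe_prop _,
    fun t ht => ?_⟩
  · exact continuous_subtype_val.comp (e.symm.continuous.comp
      (continuous_projIcc.comp (by fun_prop)))
  · have : projIcc _ _ hle (φ t - φ 0 + φ 0) = e ⟨t, ht⟩ := by
      rw [sub_add_cancel, projIcc_of_mem hle ((h.image_Icc hT) ▸ mem_image_of_mem φ ht)]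
      rfl
    simp only
    rw [this, e.symm_apply_apply]

/-- The substitution `r = φ s - φ 0` absorbs the weight `φ'`, which reduces every statement to the
case `φ = id`. -/
lemma rlIntegral_eq_fracIntegral (h : IsTimeChange T φ) {g : ℝ → ℝ}
    (hg : ∀ t ∈ Icc 0 T, g (φ t - φ 0) = t) {μ : ℝ} (hμ : μ ≠ 0) (f : ℝ → E) {t : ℝ}
    (ht : t ∈ Icc 0 T) :
    rlIntegral T φ μ f t = fracIntegral μ (f ∘ g) (φ t - φ 0) := by
  have h0 : (0 : ℝ) ∈ Icc 0 T := ⟨le_rfl, h.pos.le⟩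
  have hs : Icc 0 t ⊆ Icc 0 T := Icc_subset_Icc_right ht.2
  have hle : φ 0 ≤ φ t := h.strictMonoOn.monotoneOn h0 ht ht.1
  rw [rlIntegral, if_neg hμ, fracIntegral, intervalIntegral.integral_of_le ht.1,
    intervalIntegral.integral_of_le (sub_nonneg.2 hle), ← integral_Icc_eq_integral_Ioc,
    ← integral_Icc_eq_integral_Ioc]
  have himg : (fun s => φ s - φ 0) '' Icc 0 t = Icc 0 (φ t - φ 0) := by
    rw [← image_image (fun x => x - φ 0) φ, h.image_Icc ht]
    simp
  rw [← himg, integral_image_eq_integral_abs_deriv_smul measurableSet_Icc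
    (fun s hs' => ((h.hasDerivWithinAt (hs hs')).mono hs).sub_const (φ 0))
    (fun a ha b hb hab => h.strictMonoOn.injOn (hs ha) (hs hb) (by simpa using hab))]
  congr 1
  refine setIntegral_congr_fun measurableSet_Icc fun s hs' => ?_
  simp only [Function.comp]
  rw [abs_of_pos (h.deriv_pos s (hs hs')), hg s (hs hs'), smul_smul]
  congr 3
  ring

end IsTimeChange

end

end FractionalWave

/-! ### Calculus of `φ`-fractional integrals and Volterra uniqueness -/

namespace FractionalWave

noncomputable section

variable {E : Type*} [NormedAddCommGroup E] [NormedSpace ℝ E] {T : ℝ} {φ : ℝ → ℝ}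

lemma rlIntegral_zero_left (f : ℝ → E) : rlIntegral T φ 0 f = f := by
  ext t
  simp [rlIntegral]

lemma rlIntegral_congr {μ : ℝ} {f g : ℝ → E} (hfg : EqOn f g (Icc 0 T)) {t : ℝ}
    (ht : t ∈ Icc 0 T) : rlIntegral T φ μ f t = rlIntegral T φ μ g t := by
  unfold rlIntegral
  split_ifs with hμ
  · exact hfg ht
  congr 1
  refine intervalIntegral.integral_congr fun s hs => ?_
  rw [uIcc_of_le ht.1] at hs
  rw [hfg ⟨hs.1, hs.2.trans ht.2⟩]

lemma rlIntegral_apply_zero {μ : ℝ} (hμ : μ ≠ 0) (f : ℝ → E) : rlIntegral T φ μ f 0 = 0 := by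
  simp [rlIntegral, hμ]

lemma rlIntegral_one (f : ℝ → E) (t : ℝ) :
    rlIntegral T φ 1 f t = ∫ s in (0 : ℝ)..t, derivWithin φ (Icc 0 T) s • f s := by
  simp [rlIntegral]

lemma rlIntegral_const_smul {μ : ℝ} (c : ℝ) (f : ℝ → E) (t : ℝ) :
    rlIntegral T φ μ (fun s => c • f s) t = c • rlIntegral T φ μ f t := by
  unfold rlIntegral
  split_ifs
  · rfl
  · have hs : ∀ s, (derivWithin φ (Icc 0 T) s * (φ t - φ s) ^ (μ - 1)) • c • f s =
        c • (derivWithin φ (Icc 0 T) s * (φ t - φ s) ^ (μ - 1)) • f s :=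
      fun s => smul_comm _ _ _
    simp only [hs, intervalIntegral.integral_smul]
    exact smul_comm _ _ _

lemma phiDeriv_congr {f g : ℝ → E} (hfg : EqOn f g (Icc 0 T)) {t : ℝ} (ht : t ∈ Icc 0 T) :
    phiDeriv T φ f t = phiDeriv T φ g t := by
  rw [phiDeriv, phiDeriv, derivWithin_congr hfg (hfg ht)]

namespace IsTimeChange

lemma apply_le (h : IsTimeChange T φ) {s t : ℝ} (hs : s ∈ Icc 0 T) (ht : t ∈ Icc 0 T)
    (hst : s ≤ t) : φ s ≤ φ t :=
  h.strictMonoOn.monotoneOn hs ht hst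

lemma continuousOn_rlIntegral (h : IsTimeChange T φ) {μ : ℝ} (hμ : 0 ≤ μ) {f : ℝ → E}
    (hf : ContinuousOn f (Icc 0 T)) : ContinuousOn (rlIntegral T φ μ f) (Icc 0 T) := by
  rcases hμ.eq_or_lt with rfl | hμ
  · rwa [rlIntegral_zero_left]
  obtain ⟨g, hg, hgm, hgi⟩ := h.exists_inverse
  obtain ⟨M, hM⟩ := isCompact_Icc.exists_bound_of_continuousOn hf
  refine ContinuousOn.congr ?_ fun t ht => h.rlIntegral_eq_fracIntegral hgi hμ.ne' f ht
  refine (continuousOn_fracIntegral hμ (hf.comp_continuous hg hgm)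
    ⟨M, fun y => hM _ (hgm y)⟩).comp (h.contDiffOn.continuousOn.sub continuousOn_const) ?_
  exact fun t ht => sub_nonneg.2 (h.apply_le ⟨le_rfl, h.pos.le⟩ ht ht.1)

lemma rlIntegral_rlIntegral [CompleteSpace E] (h : IsTimeChange T φ) {a b : ℝ} (ha : 0 ≤ a)
    (hb : 0 ≤ b) {f : ℝ → E} (hf : ContinuousOn f (Icc 0 T)) {t : ℝ} (ht : t ∈ Icc 0 T) :
    rlIntegral T φ a (rlIntegral T φ b f) t = rlIntegral T φ (a + b) f t := by
  rcases ha.eq_or_lt with rfl | ha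
  · rw [rlIntegral_zero_left, zero_add]
  rcases hb.eq_or_lt with rfl | hb
  · rw [rlIntegral_zero_left, add_zero]
  obtain ⟨g, hg, hgm, hgi⟩ := h.exists_inverse
  have h0 : ∀ s ∈ Icc 0 T, 0 ≤ φ s - φ 0 := fun s hs =>
    sub_nonneg.2 (h.apply_le ⟨le_rfl, h.pos.le⟩ hs hs.1)
  have hc : Continuous (f ∘ g) := hf.comp_continuous hg hgm
  rw [h.rlIntegral_eq_fracIntegral hgi (by positivity) f ht,
    ← fracIntegral_fracIntegral ha hb (h0 t ht) hc,
    rlIntegral_congr (g := fun s => fracIntegral b (f ∘ g) (φ s - φ 0))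
      (fun s hs => h.rlIntegral_eq_fracIntegral hgi hb.ne' f hs) ht,
    h.rlIntegral_eq_fracIntegral hgi ha.ne' _ ht]
  -- The transported inner integral is evaluated at `φ (g r) - φ 0`, so `g` must also be a right
  -- inverse on the range of integration.
  have hL : ∀ r ∈ Icc 0 (φ t - φ 0), φ (g r) - φ 0 = r := by
    intro r hr
    obtain ⟨s, hs, hsr⟩ : r + φ 0 ∈ φ '' Icc 0 t := by
      rw [h.image_Icc ht]
      exact ⟨by linarith [hr.1], by linarith [hr.2]⟩
    have : r = φ s - φ 0 := by linarith
    rw [this, hgi s ⟨hs.1, hs.2.trans ht.2⟩]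
  simp only [fracIntegral]
  congr 1
  refine intervalIntegral.integral_congr fun r hr => ?_
  rw [uIcc_of_le (h0 t ht)] at hr
  simp only [Function.comp]
  rw [hL r hr]

lemma hasDerivWithinAt_rlIntegral_one [CompleteSpace E] (h : IsTimeChange T φ) {f : ℝ → E}
    (hf : ContinuousOn f (Icc 0 T)) {t : ℝ} (ht : t ∈ Icc 0 T) :
    HasDerivWithinAt (rlIntegral T φ 1 f) (derivWithin φ (Icc 0 T) t • f t) (Icc 0 T) t := by
  have hc : ContinuousOn (fun s => derivWithin φ (Icc 0 T) s • f s) (Icc 0 T) :=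
    h.continuousOn_derivWithin.smul hf
  rw [show rlIntegral T φ 1 f = _ from funext (rlIntegral_one f)]
  have : Fact (t ∈ Icc 0 T) := ⟨ht⟩
  refine intervalIntegral.integral_hasDerivWithinAt_right ?_ ?_ (hc t ht)
  · refine (hc.mono ?_).intervalIntegrable
    rw [uIcc_of_le ht.1]
    exact Icc_subset_Icc_right ht.2
  · exact ⟨Icc 0 T, self_mem_nhdsWithin, hc.aestronglyMeasurable measurableSet_Icc⟩

lemma phiDeriv_eq_of_hasDerivWithinAt (h : IsTimeChange T φ) {f : ℝ → E} {t : ℝ} {x : E}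
    (ht : t ∈ Icc 0 T)
    (hd : HasDerivWithinAt f (derivWithin φ (Icc 0 T) t • x) (Icc 0 T) t) :
    phiDeriv T φ f t = x := by
  rw [phiDeriv, hd.derivWithin (h.uniqueDiffOn t ht), inv_smul_smul₀ (h.deriv_pos t ht).ne']

lemma phiDeriv_rlIntegral_one [CompleteSpace E] (h : IsTimeChange T φ) {f : ℝ → E}
    (hf : ContinuousOn f (Icc 0 T)) {t : ℝ} (ht : t ∈ Icc 0 T) :
    phiDeriv T φ (rlIntegral T φ 1 f) t = f t :=
  h.phiDeriv_eq_of_hasDerivWithinAt ht (h.hasDerivWithinAt_rlIntegral_one hf ht)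

/-- The fundamental theorem with derivative only on the open interval and continuity up to the ends:
the Caputo equation gives no information at `0`. -/
lemma rlIntegral_one_of_phiDeriv_eq [CompleteSpace E] (h : IsTimeChange T φ) {f g : ℝ → E}
    (hf : ContinuousOn f (Icc 0 T)) (hg : ContinuousOn g (Icc 0 T)) (hf0 : f 0 = 0)
    (hd : ∀ t ∈ Ioo 0 T, DifferentiableWithinAt ℝ f (Icc 0 T) t)
    (hfg : ∀ t ∈ Ioo 0 T, phiDeriv T φ f t = g t) {t : ℝ} (ht : t ∈ Icc 0 T) :
    rlIntegral T φ 1 g t = f t := by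
  have hs : Icc 0 t ⊆ Icc 0 T := Icc_subset_Icc_right ht.2
  rw [rlIntegral_one, intervalIntegral.integral_eq_sub_of_hasDerivAt_of_le ht.1 (hf.mono hs),
    hf0, sub_zero]
  · intro s hs'
    have hsT : s ∈ Ioo 0 T := ⟨hs'.1, hs'.2.trans_le ht.2⟩
    rw [← hfg s hsT, phiDeriv, smul_inv_smul₀ (h.deriv_pos s (Ioo_subset_Icc_self hsT)).ne']
    exact (hd s hsT).hasDerivWithinAt.hasDerivAt (Icc_mem_nhds hsT.1 hsT.2)
  · refine ((h.continuousOn_derivWithin.smul hg).mono ?_).intervalIntegrable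
    rwa [uIcc_of_le ht.1]

lemma continuousOn_phiDeriv (h : IsTimeChange T φ) {f : ℝ → E}
    (hf : ContDiffOn ℝ 1 f (Icc 0 T)) : ContinuousOn (phiDeriv T φ f) (Icc 0 T) :=
  (h.continuousOn_derivWithin.inv₀ fun t ht => (h.deriv_pos t ht).ne').smul
    (hf.continuousOn_derivWithin h.uniqueDiffOn le_rfl)

/-- The kernel of the Riemann-Liouville integral of order at least `1` is bounded. -/
lemma exists_kernel_bound (h : IsTimeChange T φ) {μ : ℝ} (hμ : 1 ≤ μ) :
    ∃ A, 0 ≤ A ∧ ∀ t ∈ Icc 0 T, ∀ s ∈ Icc 0 t,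
      ‖derivWithin φ (Icc 0 T) s * (φ t - φ s) ^ (μ - 1)‖ ≤ A := by
  obtain ⟨M, hM⟩ := isCompact_Icc.exists_bound_of_continuousOn h.continuousOn_derivWithin
  have h0 : (0 : ℝ) ∈ Icc 0 T := ⟨le_rfl, h.pos.le⟩
  have hT : T ∈ Icc 0 T := ⟨h.pos.le, le_rfl⟩
  have hM0 : 0 ≤ M := (norm_nonneg _).trans (hM 0 h0)
  have hφ0 := h.apply_le h0 hT h.pos.le
  refine ⟨M * (φ T - φ 0) ^ (μ - 1), mul_nonneg hM0 (Real.rpow_nonneg (sub_nonneg.2 hφ0) _),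
    fun t ht s hs => ?_⟩
  have hsT : s ∈ Icc 0 T := ⟨hs.1, hs.2.trans ht.2⟩
  have h1 : 0 ≤ φ t - φ s := sub_nonneg.2 (h.apply_le hsT ht hs.2)
  rw [norm_mul]
  refine mul_le_mul (hM s hsT) ?_ (norm_nonneg _) hM0
  rw [Real.norm_of_nonneg (Real.rpow_nonneg h1 _)]
  exact Real.rpow_le_rpow h1 (sub_le_sub (h.apply_le ht hT ht.2) (h.apply_le h0 hsT hs.1))
    (by linarith)

lemma continuousOn_kernel (h : IsTimeChange T φ) {μ : ℝ} (hμ : 1 ≤ μ) {t : ℝ}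
    (ht : t ∈ Icc 0 T) :
    ContinuousOn (fun s => derivWithin φ (Icc 0 T) s * (φ t - φ s) ^ (μ - 1)) (Icc 0 t) := by
  have hs : Icc 0 t ⊆ Icc 0 T := Icc_subset_Icc_right ht.2
  refine (h.continuousOn_derivWithin.mono hs).mul ?_
  exact (continuousOn_const.sub (h.contDiffOn.continuousOn.mono hs)).rpow_const
    fun _ _ => Or.inr (by linarith)

/-- For `1 ≤ μ` the kernel is bounded, so bounded pointwise convergence suffices. -/
lemma tendsto_rlIntegral (h : IsTimeChange T φ) {μ : ℝ} (hμ : 1 ≤ μ)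
    {F : ℕ → ℝ → E} {f : ℝ → E} {B : ℝ} (hF : ∀ k, ContinuousOn (F k) (Icc 0 T))
    (hB : ∀ k, ∀ s ∈ Icc 0 T, ‖F k s‖ ≤ B)
    (hlim : ∀ s ∈ Icc 0 T, Filter.Tendsto (fun k => F k s) Filter.atTop (nhds (f s)))
    {t : ℝ} (ht : t ∈ Icc 0 T) :
    Filter.Tendsto (fun k => rlIntegral T φ μ (F k) t) Filter.atTop
      (nhds (rlIntegral T φ μ f t)) := by
  obtain ⟨A, hA0, hA⟩ := h.exists_kernel_bound hμ
  have hs : Icc 0 t ⊆ Icc 0 T := Icc_subset_Icc_right ht.2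
  simp only [rlIntegral, if_neg (show μ ≠ 0 by linarith), intervalIntegral.integral_of_le ht.1]
  refine Filter.Tendsto.const_smul ?_ _
  refine tendsto_integral_of_dominated_convergence (fun _ => A * B) (fun k => ?_)
    (integrable_const _) (fun k => ?_) ?_
  · exact (((h.continuousOn_kernel hμ ht).smul ((hF k).mono hs)).mono
      Ioc_subset_Icc_self).aestronglyMeasurable measurableSet_Ioc
  · refine (ae_restrict_iff' measurableSet_Ioc).2 (.of_forall fun s hs' => ?_)
    have hs' := Ioc_subset_Icc_self hs'
    rw [norm_smul]
    exact mul_le_mul (hA t ht s hs') (hB k s (hs hs')) (norm_nonneg _) hA0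
  · refine (ae_restrict_iff' measurableSet_Ioc).2 (.of_forall fun s hs' => ?_)
    exact (hlim s (hs (Ioc_subset_Icc_self hs'))).const_smul _

/-- A bounded solution of a homogeneous Volterra equation vanishes. -/
lemma eq_zero_of_eq_rlIntegral (h : IsTimeChange T φ) {μ : ℝ} (hμ : 1 ≤ μ)
    {k : ℝ → ℝ} (hk : ContinuousOn k (Icc 0 T)) {f : ℝ → E} {M : ℝ}
    (hM : ∀ t ∈ Icc 0 T, ‖f t‖ ≤ M)
    (hf : ∀ t ∈ Icc 0 T, f t = rlIntegral T φ μ (fun s => k s • f s) t) :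
    ∀ t ∈ Icc 0 T, f t = 0 := by
  obtain ⟨A, hA0, hA⟩ := h.exists_kernel_bound hμ
  obtain ⟨B, hB⟩ := isCompact_Icc.exists_bound_of_continuousOn hk
  have h0 : (0 : ℝ) ∈ Icc 0 T := ⟨le_rfl, h.pos.le⟩
  have hB0 : 0 ≤ B := (norm_nonneg _).trans (hB 0 h0)
  have hG : 0 ≤ (Real.Gamma μ)⁻¹ := inv_nonneg.2 (Real.Gamma_pos_of_pos (by linarith)).le
  -- Each use of the equation integrates the previous bound once more and gains a factor `C t / (n +
  -- 1)`. No measurability of `f` is needed, since only norms of integrals are estimated.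
  set C := (Real.Gamma μ)⁻¹ * (A * B) with hC
  have key : ∀ n : ℕ, ∀ t ∈ Icc 0 T, ‖f t‖ ≤ M * ((C * t) ^ n / n.factorial) := by
    intro n
    induction n with
    | zero => simpa using hM
    | succ n ih =>
      intro t ht
      have hint : ‖∫ s in (0 : ℝ)..t,
          (derivWithin φ (Icc 0 T) s * (φ t - φ s) ^ (μ - 1)) • k s • f s‖ ≤
          ∫ s in (0 : ℝ)..t, A * B * (M * C ^ n / n.factorial) * s ^ n := by
        refine intervalIntegral.norm_integral_le_of_norm_le ht.1 (.of_forall fun s hs => ?_)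
          (Continuous.intervalIntegrable (by fun_prop) _ _)
        have hs' := Ioc_subset_Icc_self hs
        have hsT : s ∈ Icc 0 T := ⟨hs'.1, hs'.2.trans ht.2⟩
        rw [norm_smul, norm_smul, mul_assoc (A * B), mul_assoc A]
        refine mul_le_mul (hA t ht s hs') (mul_le_mul (hB s hsT) ((ih s hsT).trans_eq ?_)
          (norm_nonneg _) hB0) (by positivity) hA0
        rw [mul_pow]
        ring
      rw [hf t ht, rlIntegral, if_neg (show μ ≠ 0 by linarith), norm_smul,
        Real.norm_of_nonneg hG]
      refine (mul_le_mul_of_nonneg_left hint hG).trans_eq ?_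
      rw [intervalIntegral.integral_const_mul, integral_pow, mul_assoc (A * B),
        ← mul_assoc (Real.Gamma μ)⁻¹, ← hC, Nat.factorial_succ]
      push_cast
      rw [mul_pow]
      field_simp
      ring
  intro t ht
  have hlim : Filter.Tendsto (fun n : ℕ => M * ((C * t) ^ n / n.factorial)) Filter.atTop
      (nhds (M * 0)) := (FloorSemiring.tendsto_pow_div_factorial_atTop (C * t)).const_mul M
  rw [mul_zero] at hlim
  exact norm_le_zero_iff.1 (ge_of_tendsto' hlim fun n => key n t ht)

end IsTimeChange

end

end FractionalWave

/-! ### Plane waves, cutoffs, the Laplacian and the Fourier transform -/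

namespace FractionalWave

noncomputable section

section Space

variable {V : Type*} [NormedAddCommGroup V] [InnerProductSpace ℝ V]
  {F : Type*} [NormedAddCommGroup F] [NormedSpace ℝ F]

/-- The real plane wave `x ↦ cos (⟪a, x⟫ + θ)`. -/
def planeWave (a : V) (θ : ℝ) (x : V) : ℝ := Real.cos (inner ℝ a x + θ)

lemma abs_planeWave_le_one (a : V) (θ : ℝ) (x : V) : |planeWave a θ x| ≤ 1 :=
  Real.abs_cos_le_one _

lemma contDiff_planeWave (a : V) (θ : ℝ) {n : ℕ∞ω} : ContDiff ℝ n (planeWave a θ) := by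
  exact Real.contDiff_cos.comp ((innerSL ℝ a).contDiff.add contDiff_const)

lemma norm_iteratedFDeriv_planeWave_le (a : V) (θ : ℝ) (i : ℕ) (x : V) :
    ‖iteratedFDeriv ℝ i (planeWave a θ) x‖ ≤ ‖a‖ ^ i := by
  have hc : ContDiff ℝ i (fun s => Real.cos (s + θ)) := by fun_prop
  have h : planeWave a θ = (fun s => Real.cos (s + θ)) ∘ innerSL ℝ a := rfl
  rw [h, (innerSL ℝ a).iteratedFDeriv_comp_right hc x le_rfl]
  refine (ContinuousMultilinearMap.norm_compContinuousLinearMap_le _ _).trans ?_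
  rw [norm_iteratedFDeriv_eq_norm_iteratedDeriv, iteratedDeriv_comp_add_const]
  simp only [innerSL_apply_norm, Finset.prod_const, Finset.card_univ, Fintype.card_fin]
  exact mul_le_of_le_one_left (by positivity) (Real.abs_iteratedDeriv_cos_le_one _ _)

variable [FiniteDimensional ℝ V]

lemma norm_laplacian_le (f : V → F) (x : V) :
    ‖Δ f x‖ ≤ Module.finrank ℝ V * ‖iteratedFDeriv ℝ 2 f x‖ := by
  rw [InnerProductSpace.laplacian_eq_iteratedFDeriv_stdOrthonormalBasis]
  refine (norm_sum_le_of_le _ fun i _ => ContinuousMultilinearMap.le_opNorm _ _).trans ?_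
  simp [Fin.prod_univ_two]

lemma continuous_laplacian {f : V → F} (hf : ContDiff ℝ 2 f) : Continuous (Δ f) := by
  rw [InnerProductSpace.laplacian_eq_iteratedFDeriv_stdOrthonormalBasis]
  have := hf.continuous_iteratedFDeriv (m := 2) le_rfl
  fun_prop

lemma tsupport_laplacian_subset (f : V → F) : tsupport (Δ f) ⊆ tsupport f := by
  refine closure_minimal (fun x hx => ?_) (isClosed_tsupport f)
  refine tsupport_iteratedFDeriv_subset (𝕜 := ℝ) 2 (subset_closure fun h => hx ?_)
  rw [InnerProductSpace.laplacian_eq_iteratedFDeriv_stdOrthonormalBasis]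
  simp [h]

lemma hasCompactSupport_laplacian {f : V → F} (hf : HasCompactSupport f) :
    HasCompactSupport (Δ f) :=
  hf.of_isClosed_subset (isClosed_tsupport _) (tsupport_laplacian_subset f)

lemma contDiff_laplacian {f : V → F} (hf : ContDiff ℝ ∞ f) : ContDiff ℝ ∞ (Δ f) := by
  rw [InnerProductSpace.laplacian_eq_iteratedFDeriv_stdOrthonormalBasis]
  have h : ContDiff ℝ ∞ (iteratedFDeriv ℝ 2 f) := hf.iteratedFDeriv_right le_rfl
  refine ContDiff.sum fun i _ => ?_
  exact (ContinuousMultilinearMap.apply ℝ (fun _ : Fin 2 => V) F _).contDiff.comp h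

lemma laplacian_planeWave (a : V) (θ : ℝ) (x : V) :
    Δ (planeWave a θ) x = -‖a‖ ^ 2 * planeWave a θ x := by
  have h1 : ∀ y, HasFDerivAt (planeWave a θ)
      (-Real.sin (inner ℝ a y + θ) • innerSL ℝ a) y := fun y =>
    (((innerSL ℝ a).hasFDerivAt (x := y)).add_const θ).cos
  have h2 : ∀ y, HasFDerivAt (fun y => -Real.sin (inner ℝ a y + θ) • innerSL ℝ a)
      ((-(Real.cos (inner ℝ a y + θ) • innerSL ℝ a)).smulRight (innerSL ℝ a)) y := fun y =>
    (((innerSL ℝ a).hasFDerivAt (x := y)).add_const θ).sin.neg.smul_const (innerSL ℝ a)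
  rw [InnerProductSpace.laplacian_eq_iteratedFDeriv_stdOrthonormalBasis]
  simp only [iteratedFDeriv_two_apply, funext fun y => (h1 y).fderiv, (h2 _).fderiv]
  rw [← (stdOrthonormalBasis ℝ V).sum_sq_inner_left a, ← Finset.sum_neg_distrib, Finset.sum_mul]
  refine Finset.sum_congr rfl fun i _ => ?_
  simp [planeWave]
  ring

/-- A smooth function with bounded derivatives of order at most two is approximated, together with
its Laplacian, pointwise and boundedly by test functions. -/
lemma exists_testFunction_approx {c : V → ℝ} (hc : ContDiff ℝ ∞ c)
    (hb : ∀ i, ∃ C, ∀ x, ‖iteratedFDeriv ℝ i c x‖ ≤ C) :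
    ∃ (ψ : ℕ → V → ℝ) (B : ℝ), (∀ k, ContDiff ℝ ∞ (ψ k)) ∧ (∀ k, HasCompactSupport (ψ k)) ∧
      (∀ k x, |ψ k x| ≤ B) ∧ (∀ k x, |Δ (ψ k) x| ≤ B) ∧
      ∀ x, ∀ᶠ k in Filter.atTop, ψ k x = c x ∧ Δ (ψ k) x = Δ c x := by
  -- The approximants are `χ(x / (k + 1)) c(x)`. The dilations have norm at most `1`, so the
  -- derivatives of the cutoffs are bounded uniformly in `k`; near a given point the cutoff is
  -- eventually equal to `1`.
  let χ : ContDiffBump (0 : V) := ⟨1, 2, one_pos, one_lt_two⟩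
  have hχ : ContDiff ℝ ∞ χ := χ.contDiff
  have hχb : ∀ i, ∃ C, ∀ x, ‖iteratedFDeriv ℝ i χ x‖ ≤ C := fun i =>
    ((χ.hasCompactSupport.iteratedFDeriv (𝕜 := ℝ) i).exists_bound_of_continuous
      (hχ.continuous_iteratedFDeriv (m := i) (by exact_mod_cast le_top)))
  choose C hC using hb
  choose D hD using hχb
  have hC0 : ∀ i, 0 ≤ C i := fun i => (norm_nonneg _).trans (hC i 0)
  have hD0 : ∀ i, 0 ≤ D i := fun i => (norm_nonneg _).trans (hD i 0)
  let r : ℕ → ℝ := fun k => ((k : ℝ) + 1)⁻¹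
  have hr0 : ∀ k, 0 < r k := fun k => by positivity
  have hr1 : ∀ k, r k ≤ 1 := fun k => inv_le_one_of_one_le₀ (by simp)
  let L : ℕ → V →L[ℝ] V := fun k => r k • ContinuousLinearMap.id ℝ V
  have hL : ∀ k, ‖L k‖ ≤ 1 := fun k => by
    rw [norm_smul, Real.norm_of_nonneg (hr0 k).le]
    exact mul_le_one₀ (hr1 k) (norm_nonneg _) ContinuousLinearMap.norm_id_le
  have hψL : ∀ k, ContDiff ℝ ∞ (χ ∘ L k) := fun k => hχ.comp (L k).contDiff
  have hder : ∀ k i x, ‖iteratedFDeriv ℝ i (χ ∘ L k) x‖ ≤ D i := fun k i x => by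
    rw [(L k).iteratedFDeriv_comp_right hχ x (by exact_mod_cast le_top)]
    refine (ContinuousMultilinearMap.norm_compContinuousLinearMap_le _ _).trans ?_
    refine (mul_le_of_le_one_right (norm_nonneg _) ?_).trans (hD i _)
    exact Finset.prod_le_one (fun _ _ => norm_nonneg _) fun _ _ => hL k
  have hderψ : ∀ i : ℕ, ∃ B, ∀ k x, ‖iteratedFDeriv ℝ i (fun y => (χ ∘ L k) y * c y) x‖ ≤ B := by
    intro i
    refine ⟨∑ j ∈ Finset.range (i + 1), (i.choose j : ℝ) * D j * C (i - j), fun k x => ?_⟩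
    refine (norm_iteratedFDeriv_mul_le (hψL k) hc x (by exact_mod_cast le_top)).trans ?_
    refine Finset.sum_le_sum fun j _ => ?_
    exact mul_le_mul (mul_le_mul_of_nonneg_left (hder k j x) (by positivity)) (hC _ x)
      (norm_nonneg _) (mul_nonneg (by positivity) (hD0 j))
  obtain ⟨B₀, hB₀⟩ := hderψ 0
  obtain ⟨B₂, hB₂⟩ := hderψ 2
  refine ⟨fun k y => (χ ∘ L k) y * c y, max B₀ (Module.finrank ℝ V * B₂),
    fun k => (hψL k).mul hc, fun k => ?_, fun k x => ?_, fun k x => ?_, fun x => ?_⟩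
  · refine HasCompactSupport.mul_right ?_
    exact χ.hasCompactSupport.comp_homeomorph (Homeomorph.smulOfNeZero (r k) (hr0 k).ne')
  · refine le_max_of_le_left ?_
    rw [← Real.norm_eq_abs]
    simpa only [norm_iteratedFDeriv_zero] using hB₀ k x
  · rw [← Real.norm_eq_abs]
    refine le_max_of_le_right ((norm_laplacian_le _ x).trans ?_)
    exact mul_le_mul_of_nonneg_left (hB₂ k x) (by positivity)
  · obtain ⟨N, hN⟩ := exists_nat_gt ‖x‖
    filter_upwards [Filter.eventually_ge_atTop N] with k hk
    have hev : (fun y => (χ ∘ L k) y * c y) =ᶠ[nhds x] c := by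
      have hlt : ‖x‖ < k + 1 := by
        have : (N : ℝ) ≤ k := by exact_mod_cast hk
        linarith
      filter_upwards [(isOpen_lt continuous_norm continuous_const).mem_nhds hlt] with y hy
      have : χ (L k y) = 1 := by
        refine χ.one_of_mem_closedBall ?_
        have hk1 : (0 : ℝ) < k + 1 := by positivity
        simp only [mem_closedBall_zero_iff]
        change ‖r k • y‖ ≤ 1
        rw [norm_smul, Real.norm_of_nonneg (hr0 k).le, inv_mul_le_iff₀ hk1, mul_one]
        exact le_of_lt hy
      simp [this]
    exact ⟨hev.eq_of_nhds, (InnerProductSpace.laplacian_congr_nhds hev).eq_of_nhds⟩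

lemma laplacian_eq_sum_fderiv {u : V → F} (hu : ContDiff ℝ 2 u) (x : V) :
    Δ u x = ∑ i, fderiv ℝ (fun y => fderiv ℝ u y
      (stdOrthonormalBasis ℝ V i)) x (stdOrthonormalBasis ℝ V i) := by
  rw [InnerProductSpace.laplacian_eq_iteratedFDeriv_stdOrthonormalBasis]
  refine Finset.sum_congr rfl fun i _ => ?_
  rw [iteratedFDeriv_two_apply, fderiv_clm_apply
    ((hu.fderiv_right (m := 1) (by norm_num)).differentiable (by norm_num) x)
    (differentiableAt_const _)]
  simp

variable [MeasurableSpace V] [BorelSpace V]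

/-- Two integrations by parts in each basis direction. Only `g` has compact support, so that `f` may
be a plane wave. -/
lemma integral_smul_laplacian {f : V → ℝ} {g : V → F} (hf : ContDiff ℝ 2 f)
    (hg : ContDiff ℝ 2 g) (hgc : HasCompactSupport g) :
    ∫ x, f x • Δ g x = ∫ x, Δ f x • g x := by
  have hf1 : ∀ v, ContDiff ℝ 1 (fun x => fderiv ℝ f x v) := fun v =>
    (hf.fderiv_right (m := 1) (by norm_num)).clm_apply contDiff_const
  have hg1 : ∀ v, ContDiff ℝ 1 (fun x => fderiv ℝ g x v) := fun v =>
    (hg.fderiv_right (m := 1) (by norm_num)).clm_apply contDiff_const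
  have hf2 : ∀ v, Continuous (fun x => fderiv ℝ (fun y => fderiv ℝ f y v) x v) := fun v =>
    ((hf1 v).continuous_fderiv (by norm_num)).clm_apply continuous_const
  have hg2 : ∀ v, Continuous (fun x => fderiv ℝ (fun y => fderiv ℝ g y v) x v) := fun v =>
    ((hg1 v).continuous_fderiv (by norm_num)).clm_apply continuous_const
  have hgc1 : ∀ v, HasCompactSupport (fun x => fderiv ℝ g x v) := fun v =>
    hgc.fderiv_apply (𝕜 := ℝ) v
  have hgc2 : ∀ v, HasCompactSupport (fun x => fderiv ℝ (fun y => fderiv ℝ g y v) x v) := fun v =>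
    (hgc1 v).fderiv_apply (𝕜 := ℝ) v
  have key : ∀ v, ∫ x, f x • fderiv ℝ (fun y => fderiv ℝ g y v) x v =
      ∫ x, fderiv ℝ (fun y => fderiv ℝ f y v) x v • g x := by
    intro v
    rw [integral_smul_fderiv_eq_neg_fderiv_smul_of_integrable
        (((hf1 v).continuous.smul (hg1 v).continuous).integrable_of_hasCompactSupport
          (hgc1 v).smul_left)
        ((hf.continuous.smul (hg2 v)).integrable_of_hasCompactSupport (hgc2 v).smul_left)
        ((hf.continuous.smul (hg1 v).continuous).integrable_of_hasCompactSupport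
          (hgc1 v).smul_left)
        (fun x _ => (hf.differentiable (by norm_num)).differentiableAt)
        (fun x _ => ((hg1 v).differentiable (by norm_num)).differentiableAt),
      integral_smul_fderiv_eq_neg_fderiv_smul_of_integrable
        (((hf2 v).smul hg.continuous).integrable_of_hasCompactSupport hgc.smul_left)
        (((hf1 v).continuous.smul (hg1 v).continuous).integrable_of_hasCompactSupport
          (hgc1 v).smul_left)
        (((hf1 v).continuous.smul hg.continuous).integrable_of_hasCompactSupport hgc.smul_left)
        (fun x _ => ((hf1 v).differentiable (by norm_num)).differentiableAt)
        (fun x _ => (hg.differentiable (by norm_num)).differentiableAt), neg_neg]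
  simp only [laplacian_eq_sum_fderiv hg, laplacian_eq_sum_fderiv hf, Finset.smul_sum,
    Finset.sum_smul]
  rw [integral_finsetSum (f := fun i x => f x • fderiv ℝ (fun y => fderiv ℝ g y
      (stdOrthonormalBasis ℝ V i)) x (stdOrthonormalBasis ℝ V i)) _ fun i _ =>
        (hf.continuous.smul (hg2 _)).integrable_of_hasCompactSupport (hgc2 _).smul_left,
    integral_finsetSum (f := fun i x => fderiv ℝ (fun y => fderiv ℝ f y
      (stdOrthonormalBasis ℝ V i)) x (stdOrthonormalBasis ℝ V i) • g x) _ fun i _ =>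
        ((hf2 _).smul hg.continuous).integrable_of_hasCompactSupport hgc.smul_left]
  exact Finset.sum_congr rfl fun i _ => key _

open FourierTransform SchwartzMap in
-- Fubini, with the symmetry of the inner product.
lemma integral_fourierInv_mul {f h : V → ℂ} (hf : Integrable f) (hh : Integrable h) :
    ∫ ξ, 𝓕⁻ f ξ * h ξ = ∫ x, f x * 𝓕⁻ h x := by
  have hflip : (-innerₗ V).flip = -innerₗ V := by
    ext x y
    simp [real_inner_comm]
  have := VectorFourier.integral_fourierIntegral_smul_eq_flip (L := -innerₗ V) (μ := volume)
    (ν := volume) Real.continuous_fourierChar (by simpa using! continuous_inner.neg) hf hh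
  rwa [hflip] at this

open FourierTransform SchwartzMap in
/-- If the Fourier transforms of `f` and `g` satisfy `ĝ = -(2π|ξ|)² f̂`, then `g` is the
distributional Laplacian of `f`. -/
lemma integral_laplacian_smul_of_fourierInv_eq {f g : V → ℂ} (hf : Integrable f)
    (hg : Integrable g)
    (hfg : ∀ ξ, 𝓕⁻ g ξ = -(2 * Real.pi * ‖ξ‖ : ℝ) ^ 2 * 𝓕⁻ f ξ)
    {ψ : V → ℝ} (hψ : ContDiff ℝ ∞ ψ) (hψc : HasCompactSupport ψ) :
    ∫ x, Δ ψ x • f x = ∫ x, ψ x • g x := by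
  let c : V → ℂ := Complex.ofRealCLM ∘ ψ
  have hc : ContDiff ℝ ∞ c := Complex.ofRealCLM.contDiff.comp hψ
  have hcc : HasCompactSupport c := hψc.comp_left (map_zero _)
  let S : 𝓢(V, ℂ) := hcc.toSchwartzMap hc
  let P : 𝓢(V, ℂ) := 𝓕 S
  -- With `P` the transform of `ψ`, one has `Δψ = -(2π)² 𝓕⁻(‖ξ‖² P)`. Moving `𝓕⁻` from this Schwartz
  -- function onto `f` makes the hypothesis `hfg` applicable.
  let h : 𝓢(V, ℂ) := smulLeftCLM ℂ (fun ξ : V => ‖ξ‖ ^ 2) P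
  have hh : ∀ ξ, h ξ = (‖ξ‖ ^ 2 : ℝ) * P ξ := fun ξ => by
    rw [smulLeftCLM_apply_apply (by fun_prop), Complex.real_smul]
  have hΔ : ∀ x, (Δ ψ x : ℂ) = -(2 * Real.pi) ^ 2 * 𝓕⁻ (h : V → ℂ) x := fun x => by
    have h1 : Δ c x = (Δ ψ x : ℂ) :=
      ContDiffAt.laplacian_CLM_comp_left (l := Complex.ofRealCLM)
        (hψ.contDiffAt.of_le (by norm_cast))
    have h2 : Δ S x = Δ c x := laplacian_apply S x
    rw [← h1, ← h2, laplacian_eq_fourierMultiplierCLM, fourierMultiplierCLM_apply,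
      ← fourierInv_coe]
    simp [h, P]
  have hS : ∀ x, (ψ x : ℂ) = 𝓕⁻ (P : V → ℂ) x := fun x => by
    rw [← fourierInv_coe, FourierTransform.fourierInv_fourier_eq]
    rfl
  simp only [Complex.real_smul, hΔ, hS]
  calc ∫ x, -(2 * Real.pi) ^ 2 * 𝓕⁻ (h : V → ℂ) x * f x
      = -(2 * Real.pi) ^ 2 * ∫ x, f x * 𝓕⁻ (h : V → ℂ) x := by
        rw [← integral_const_mul]
        congr 1 with x
        ring
    _ = ∫ ξ, -(2 * Real.pi) ^ 2 * (𝓕⁻ f ξ * h ξ) := by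
        rw [← integral_fourierInv_mul hf h.integrable, integral_const_mul]
    _ = ∫ ξ, 𝓕⁻ g ξ * P ξ := by
        congr 1 with ξ
        rw [hh, hfg]
        push_cast
        ring
    _ = ∫ x, 𝓕⁻ (P : V → ℂ) x * g x := by
        rw [integral_fourierInv_mul hg P.integrable]
        congr 1 with x
        ring

/-- If the pairings of `f` and `g` with all plane waves are those of a function and its Laplacian,
then `g` is the distributional Laplacian of `f`. -/
lemma integral_laplacian_smul_of_planeWave {f g : V → ℂ} (hf : Integrable f)
    (hg : Integrable g)
    (hfg : ∀ a θ, ∫ x, planeWave a θ x • g x = -‖a‖ ^ 2 • ∫ x, planeWave a θ x • f x)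
    {ψ : V → ℝ} (hψ : ContDiff ℝ ∞ ψ) (hψc : HasCompactSupport ψ) :
    ∫ x, Δ ψ x • f x = ∫ x, ψ x • g x := by
  refine integral_laplacian_smul_of_fourierInv_eq hf hg (fun ξ => ?_) hψ hψc
  have hint : ∀ {u : V → ℂ}, Integrable u → ∀ a θ,
      Integrable (fun x => planeWave a θ x • u x) := fun hu a θ =>
    hu.bdd_smul 1 (contDiff_planeWave (n := 0) a θ).continuous.aestronglyMeasurable
      (.of_forall fun x => abs_planeWave_le_one a θ x)
  -- The phases `0` and `-π/2` give the cosine and the sine, that is, the real and imaginary parts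
  -- of the Fourier kernel.
  have key : ∀ {u : V → ℂ}, Integrable u → FourierTransformInv.fourierInv u ξ =
      (∫ x, planeWave ((2 * Real.pi) • ξ) 0 x • u x) + Complex.I *
        ∫ x, planeWave ((2 * Real.pi) • ξ) (-(Real.pi / 2)) x • u x := by
    intro u hu
    rw [Real.fourierInv_eq', ← integral_const_mul,
      ← integral_add (hint hu _ _) ((hint hu _ _).const_mul _)]
    congr 1 with x
    simp only [planeWave, Complex.real_smul, smul_eq_mul, add_zero, ← sub_eq_add_neg,
      Real.cos_sub_pi_div_two, inner_smul_left, Complex.exp_mul_I, real_inner_comm x ξ]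
    push_cast
    simp
    ring
  rw [key hf, key hg, hfg, hfg, norm_smul, Real.norm_of_nonneg (by positivity)]
  simp only [Complex.real_smul]
  push_cast
  ring

end Space

end

end FractionalWave

/-! ### From the Caputo equation to integral equations -/

namespace FractionalWave

noncomputable section

variable {E : Type*} [NormedAddCommGroup E] [NormedSpace ℝ E] {T : ℝ} {φ : ℝ → ℝ} {α : ℝ}

lemma natCeil_eq_two (hα₁ : 1 < α) (hα₂ : α ≤ 2) : ⌈α⌉₊ = 2 := by
  rw [Nat.ceil_eq_iff two_ne_zero]
  norm_num
  exact ⟨hα₁, hα₂⟩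

lemma rlDeriv_eq (hα₁ : 1 < α) (hα₂ : α ≤ 2) (f : ℝ → E) :
    rlDeriv T φ α f = phiDeriv T φ (phiDeriv T φ (rlIntegral T φ (2 - α) f)) := by
  rw [rlDeriv, natCeil_eq_two hα₁ hα₂]
  rfl

lemma taylorRemainder_eq (hα₁ : 1 < α) (hα₂ : α ≤ 2) (f : ℝ → E) (t : ℝ) :
    taylorRemainder T φ α f t = f t - (f 0 + (φ t - φ 0) • phiDeriv T φ f 0) := by
  rw [taylorRemainder, natCeil_eq_two hα₁ hα₂]
  simp [Finset.sum_range_succ]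

namespace IsTimeChange

variable [CompleteSpace E]

/-- The fractional derivative is a left inverse of the fractional integral. -/
lemma rlDifferentiable_and_rlDeriv_eq (h : IsTimeChange T φ) (hα₁ : 1 < α) (hα₂ : α ≤ 2)
    {f g : ℝ → E} (hg : ContinuousOn g (Icc 0 T))
    (hf : ∀ t ∈ Icc 0 T, f t = rlIntegral T φ α g t) :
    RLDifferentiable T φ α f ∧ ∀ t ∈ Icc 0 T, rlDeriv T φ α f t = g t := by
  have hG := h.continuousOn_rlIntegral zero_le_one hg
  -- `I^(2-α) I^α = I^2 = I^1 I^1`, which two derivatives undo one after the other.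
  have e0 : EqOn (rlIntegral T φ (2 - α) f) (rlIntegral T φ 1 (rlIntegral T φ 1 g)) (Icc 0 T) := by
    intro t ht
    rw [rlIntegral_congr hf ht, h.rlIntegral_rlIntegral (by linarith) (by linarith) hg ht,
      h.rlIntegral_rlIntegral zero_le_one zero_le_one hg ht]
    norm_num
  have e1 : EqOn (phiDeriv T φ (rlIntegral T φ (2 - α) f)) (rlIntegral T φ 1 g) (Icc 0 T) :=
    fun t ht => by rw [phiDeriv_congr e0 ht, h.phiDeriv_rlIntegral_one hG ht]
  constructor
  · intro k hk t ht
    have ht := Ioc_subset_Icc_self ht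
    rw [natCeil_eq_two hα₁ hα₂] at hk ⊢
    interval_cases k
    · exact ((h.hasDerivWithinAt_rlIntegral_one hG ht).congr e0 (e0 ht)).differentiableWithinAt
    · exact ((h.hasDerivWithinAt_rlIntegral_one hg ht).congr e1 (e1 ht)).differentiableWithinAt
  · intro t ht
    rw [rlDeriv_eq hα₁ hα₂, phiDeriv_congr e1 ht, h.phiDeriv_rlIntegral_one hg ht]

/-- A Caputo differential equation for a continuously differentiable function is equivalent to an
integral equation. -/
lemma eq_of_caputoDeriv_eq (h : IsTimeChange T φ) (hα₁ : 1 < α) (hα₂ : α ≤ 2)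
    {f g : ℝ → E} (hf : ContDiffOn ℝ 1 f (Icc 0 T)) (hg : ContinuousOn g (Icc 0 T))
    (hd : RLDifferentiable T φ α (taylorRemainder T φ α f))
    (hfg : ∀ t ∈ Ioc 0 T, caputoDeriv T φ α f t = g t) {t : ℝ} (ht : t ∈ Icc 0 T) :
    f t = f 0 + (φ t - φ 0) • phiDeriv T φ f 0 + rlIntegral T φ α g t := by
  have h0 : (0 : ℝ) ∈ Icc 0 T := ⟨le_rfl, h.pos.le⟩
  set R := taylorRemainder T φ α f with hR
  have hRt : ∀ s, R s = f s - (f 0 + (φ s - φ 0) • phiDeriv T φ f 0) :=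
    taylorRemainder_eq hα₁ hα₂ f
  have hRc : ContDiffOn ℝ 1 R (Icc 0 T) := by
    rw [show R = _ from funext hRt]
    exact hf.sub (contDiffOn_const.add ((h.contDiffOn.sub contDiffOn_const).smul contDiffOn_const))
  set r := phiDeriv T φ R with hr
  have hrc : ContinuousOn r (Icc 0 T) := h.continuousOn_phiDeriv hRc
  -- The Taylor polynomial was subtracted so that `R` and `δR` vanish at `0`. Thus `R = I^1 r`, and
  -- one derivative commutes with `I^(2-α)`.
  have hr0 : r 0 = 0 := by
    have h1 := (hf.differentiableOn one_ne_zero 0 h0).hasDerivWithinAt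
    have h2 := h1.sub ((((h.hasDerivWithinAt h0).sub_const (φ 0)).smul_const
      (phiDeriv T φ f 0)).const_add (f 0))
    refine h.phiDeriv_eq_of_hasDerivWithinAt h0 ?_
    rw [show R = _ from funext hRt]
    convert! h2 using 1
    rw [phiDeriv, smul_inv_smul₀ (h.deriv_pos 0 h0).ne', sub_self, smul_zero]
  have hRr : ∀ s ∈ Icc 0 T, R s = rlIntegral T φ 1 r s := fun s hs =>
    (h.rlIntegral_one_of_phiDeriv_eq hRc.continuousOn hrc (by simp [hRt])
      (fun s hs => hRc.differentiableOn one_ne_zero s (Ioo_subset_Icc_self hs))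
      (fun _ _ => rfl) hs).symm
  have hμ : 0 ≤ 2 - α := by linarith
  have hμc := h.continuousOn_rlIntegral hμ hrc
  have e1 : EqOn (phiDeriv T φ (rlIntegral T φ (2 - α) R)) (rlIntegral T φ (2 - α) r)
      (Icc 0 T) := by
    intro s hs
    rw [phiDeriv_congr (g := rlIntegral T φ 1 (rlIntegral T φ (2 - α) r)) (fun y hy => ?_) hs,
      h.phiDeriv_rlIntegral_one hμc hs]
    rw [rlIntegral_congr hRr hy, h.rlIntegral_rlIntegral hμ zero_le_one hrc hy,
      h.rlIntegral_rlIntegral zero_le_one hμ hrc hy, add_comm]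
  -- For `α = 2` the integral is the identity and `hr0` is needed; for `α < 2` the integral over a
  -- degenerate interval vanishes.
  have hz : rlIntegral T φ (2 - α) r 0 = 0 := by
    rcases hμ.eq_or_lt with h' | h'
    · rw [← h', rlIntegral_zero_left, hr0]
    · exact rlIntegral_apply_zero h'.ne' r
  have e2 : EqOn (rlIntegral T φ (2 - α) r) (rlIntegral T φ 1 g) (Icc 0 T) := by
    intro s hs
    refine (h.rlIntegral_one_of_phiDeriv_eq hμc hg hz (fun y hy => ?_) (fun y hy => ?_) hs).symm
    · have := hd 1 (by rw [natCeil_eq_two hα₁ hα₂]; norm_num) y (Ioo_subset_Ioc_self hy)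
      rw [natCeil_eq_two hα₁ hα₂] at this
      exact this.congr (fun z hz => (e1 hz).symm) (e1 (Ioo_subset_Icc_self hy)).symm
    · rw [← phiDeriv_congr e1 (Ioo_subset_Icc_self hy), ← hfg y (Ioo_subset_Ioc_self hy),
        caputoDeriv, rlDeriv_eq hα₁ hα₂]
  -- Applying `I^(α-1)` to `I^(2-α) r = I^1 g` gives `I^1 r = I^α g`.
  have e3 : R t = rlIntegral T φ α g t := by
    have h1 := h.rlIntegral_rlIntegral (a := α - 1) (by linarith) hμ hrc ht
    have h2 := h.rlIntegral_rlIntegral (a := α - 1) (by linarith) zero_le_one hg ht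
    rw [rlIntegral_congr e2 ht, h2] at h1
    rw [hRr t ht]
    convert h1.symm using 2 <;> ring
  rw [← e3, hRt]
  abel

end IsTimeChange

variable {n : ℕ} {Θ : ℝ → ℝ} {g : EuclideanSpace ℝ (Fin n) → ℂ}
  {w : EuclideanSpace ℝ (Fin n) → ℝ → ℂ}

lemma IsSolution.pairing_zero (hw : IsSolution T φ α Θ g w) (ψ : EuclideanSpace ℝ (Fin n) → ℝ) :
    pairing ψ w 0 = 0 := by
  simp [pairing, hw.initial]

lemma IsSolution.pairing_eq (hw : IsSolution T φ α Θ g w) (h : IsTimeChange T φ)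
    (hα₁ : 1 < α) (hα₂ : α ≤ 2) (hΘ : ContinuousOn Θ (Icc 0 T))
    {ψ : EuclideanSpace ℝ (Fin n) → ℝ} (hψ : ContDiff ℝ ∞ ψ) (hψc : HasCompactSupport ψ)
    {t : ℝ} (ht : t ∈ Icc 0 T) :
    pairing ψ w t = (φ t - φ 0) • (∫ x, ψ x • g x) +
      rlIntegral T φ α (fun s => Θ s • pairing (Δ ψ) w s) t := by
  have hc := (hw.contDiffOn _ (contDiff_laplacian hψ)
    (hasCompactSupport_laplacian hψc)).continuousOn
  have := h.eq_of_caputoDeriv_eq hα₁ hα₂ (hw.contDiffOn ψ hψ hψc) (hΘ.smul hc)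
    (hw.caputo_exists ψ hψ hψc)
    (fun s hs => sub_eq_zero.1 (hw.equation ψ hψ hψc s hs)) ht
  rwa [hw.pairing_zero, zero_add, hw.initial_deriv ψ hψ hψc] at this

/-- Pairings of an integrable function with boundedly and pointwise convergent functions. -/
lemma tendsto_integral_smul {V : Type*} [MeasureSpace V] {f : V → ℂ}
    (hf : Integrable f) {ψ : ℕ → V → ℝ} {c : V → ℝ} {B : ℝ}
    (hψ : ∀ k, AEStronglyMeasurable (ψ k)) (hB : ∀ k x, |ψ k x| ≤ B)
    (hlim : ∀ x, ∀ᶠ k in Filter.atTop, ψ k x = c x) :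
    Filter.Tendsto (fun k => ∫ x, ψ k x • f x) Filter.atTop (nhds (∫ x, c x • f x)) := by
  refine tendsto_integral_of_dominated_convergence (fun x => B * ‖f x‖)
    (fun k => (hψ k).smul hf.aestronglyMeasurable) (hf.norm.const_mul B)
    (fun k => .of_forall fun x => ?_) (.of_forall fun x => ?_)
  · rw [norm_smul]
    exact mul_le_mul_of_nonneg_right (hB k x) (norm_nonneg _)
  · refine tendsto_const_nhds.congr' ?_
    filter_upwards [hlim x] with k hk
    rw [hk]

/-- The bound depends on the test function only through its supremum, so it survives the removal of
cutoffs. -/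
lemma IsSolution.norm_pairing_le (hw : IsSolution T φ α Θ g w) : ∃ M, 0 ≤ M ∧
    ∀ (ψ : EuclideanSpace ℝ (Fin n) → ℝ) (B : ℝ), (∀ x, |ψ x| ≤ B) → ∀ t ∈ Icc 0 T,
      ‖pairing ψ w t‖ ≤ B * M := by
  obtain ⟨M, hM⟩ := hw.bounded_L1
  refine ⟨max M 0, le_max_right _ _, fun ψ B hB t ht => ?_⟩
  have hB0 : 0 ≤ B := (abs_nonneg _).trans (hB 0)
  refine (norm_integral_le_of_norm_le ((hM t ht).1.norm.const_mul B)
    (.of_forall fun x => ?_)).trans ?_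
  · rw [norm_smul]
    exact mul_le_mul_of_nonneg_right (hB x) (norm_nonneg _)
  · rw [integral_const_mul]
    exact mul_le_mul_of_nonneg_left ((hM t ht).2.trans (le_max_left _ _)) hB0

/-- The integral equation for the pairing of a solution with a plane wave. -/
lemma IsSolution.pairing_planeWave_eq (hw : IsSolution T φ α Θ g w) (h : IsTimeChange T φ)
    (hα₁ : 1 < α) (hα₂ : α ≤ 2) (hΘ : ContinuousOn Θ (Icc 0 T)) (hg : Integrable g)
    (a : EuclideanSpace ℝ (Fin n)) (θ : ℝ) {t : ℝ} (ht : t ∈ Icc 0 T) :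
    pairing (planeWave a θ) w t = (φ t - φ 0) • (∫ x, planeWave a θ x • g x) +
      rlIntegral T φ α (fun s => (-‖a‖ ^ 2 * Θ s) • pairing (planeWave a θ) w s) t := by
  obtain ⟨ψ, B, hψ, hψc, hB, hBΔ, hlim⟩ := exists_testFunction_approx (contDiff_planeWave a θ)
    fun i => ⟨_, norm_iteratedFDeriv_planeWave_le a θ i⟩
  obtain ⟨M, hM0, hM⟩ := hw.norm_pairing_le
  obtain ⟨C, hC⟩ := isCompact_Icc.exists_bound_of_continuousOn hΘ
  obtain ⟨_, hint⟩ := hw.bounded_L1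
  have hψm : ∀ k, AEStronglyMeasurable (ψ k) := fun k => (hψ k).continuous.aestronglyMeasurable
  have hψΔ := fun k => contDiff_laplacian (hψ k)
  have hψΔc := fun k => hasCompactSupport_laplacian (hψc k)
  have l1 := tendsto_integral_smul (hint t ht).1 hψm hB fun x => (hlim x).mono fun _ h => h.1
  have l2 := (tendsto_integral_smul hg hψm hB fun x =>
    (hlim x).mono fun _ h => h.1).const_smul (φ t - φ 0)
  have hC0 : 0 ≤ C := (norm_nonneg _).trans (hC t ht)
  have l3 := h.tendsto_rlIntegral (F := fun k s => Θ s • pairing (Δ (ψ k)) w s)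
    (f := fun s => (-‖a‖ ^ 2 * Θ s) • pairing (planeWave a θ) w s) (B := C * (B * M)) hα₁.le
    (fun k => hΘ.smul (hw.contDiffOn _ (hψΔ k) (hψΔc k)).continuousOn)
    (fun k s hs => ?_) (fun s hs => ?_) ht
  · refine tendsto_nhds_unique l1 ((l2.add l3).congr fun k => ?_)
    exact (hw.pairing_eq h hα₁ hα₂ hΘ (hψ k) (hψc k) ht).symm
  · rw [norm_smul]
    exact mul_le_mul (hC s hs) (hM _ B (hBΔ k) s hs) (norm_nonneg _) hC0
  · have := (tendsto_integral_smul (hint s hs).1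
      (fun k => (hψΔ k).continuous.aestronglyMeasurable) hBΔ
      fun x => (hlim x).mono fun _ h => h.2).const_smul (Θ s)
    have e : Θ s • ∫ x, Δ (planeWave a θ) x • w x s =
        (-‖a‖ ^ 2 * Θ s) • pairing (planeWave a θ) w s := by
      simp only [laplacian_planeWave, mul_smul, integral_smul, pairing]
      exact smul_comm _ _ _
    rwa [e] at this

end

end FractionalWave

/-! ### The identity `v = Δw` and evaluation at a point -/

namespace FractionalWave

noncomputable section

variable {T : ℝ} {φ : ℝ → ℝ} {α : ℝ}

/-- Integrability replaces continuity because plane-wave pairings are used here only as bounded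
measurable functions of time. -/
lemma IsTimeChange.rlIntegral_add {E : Type*} [NormedAddCommGroup E] [NormedSpace ℝ E]
    (h : IsTimeChange T φ) {μ : ℝ} (hμ : 1 ≤ μ) {f g : ℝ → E}
    (hf : IntegrableOn f (Icc 0 T)) (hg : IntegrableOn g (Icc 0 T)) {t : ℝ}
    (ht : t ∈ Icc 0 T) :
    rlIntegral T φ μ (fun s => f s + g s) t = rlIntegral T φ μ f t + rlIntegral T φ μ g t := by
  have hs : Icc 0 t ⊆ Icc 0 T := Icc_subset_Icc_right ht.2
  have hint : ∀ {u : ℝ → E}, IntegrableOn u (Icc 0 T) → IntervalIntegrable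
      (fun s => (derivWithin φ (Icc 0 T) s * (φ t - φ s) ^ (μ - 1)) • u s) volume 0 t := by
    intro u hu
    rw [intervalIntegrable_iff_integrableOn_Icc_of_le ht.1]
    exact (hu.mono_set hs).continuousOn_smul (h.continuousOn_kernel hμ ht) isCompact_Icc
  simp only [rlIntegral, if_neg (show μ ≠ 0 by linarith), smul_add]
  rw [intervalIntegral.integral_add (hint hf) (hint hg), smul_add]

lemma contDiff_of_contDiffOn_of_tsupport_subset {V F : Type*} [NormedAddCommGroup V]
    [NormedSpace ℝ V] [NormedAddCommGroup F] [NormedSpace ℝ F] {k : ℕ∞ω} {f : V → F} {Ω : Set V}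
    (hΩ : IsOpen Ω) (hf : ContDiffOn ℝ k f Ω) (hsupp : tsupport f ⊆ Ω) : ContDiff ℝ k f := by
  refine contDiff_iff_contDiffAt.2 fun x => ?_
  by_cases hx : x ∈ Ω
  · exact hf.contDiffAt (hΩ.mem_nhds hx)
  · refine (contDiffAt_const (c := (0 : F))).congr_of_eventuallyEq ?_
    exact notMem_tsupport_iff_eventuallyEq.1 fun h => hx (hsupp h)

variable {n : ℕ} {Θ : ℝ → ℝ} {g : EuclideanSpace ℝ (Fin n) → ℂ}
  {w v : EuclideanSpace ℝ (Fin n) → ℝ → ℂ}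

lemma IsSolution.continuous (hw : IsSolution T φ α Θ g w) {t : ℝ} (ht : t ∈ Icc 0 T) :
    Continuous fun x => w x t :=
  hw.continuousOn.comp_continuous (by fun_prop : Continuous fun x => (x, t))
    fun _ => ⟨mem_univ _, ht⟩

/-- Joint continuity gives measurability in `t` of the integral over `x`; the uniform `L¹` bound
does the rest. -/
lemma IsSolution.integrableOn_pairing (hw : IsSolution T φ α Θ g w)
    {c : EuclideanSpace ℝ (Fin n) → ℝ} (hc : Continuous c) {B : ℝ} (hB : ∀ x, |c x| ≤ B) :
    IntegrableOn (pairing c w) (Icc 0 T) := by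
  obtain ⟨M, -, hM⟩ := hw.norm_pairing_le
  refine Integrable.of_bound ?_ (B * M)
    ((ae_restrict_iff' measurableSet_Icc).2 (.of_forall fun t ht => hM c B hB t ht))
  have h1 : ContinuousOn (fun p : EuclideanSpace ℝ (Fin n) × ℝ => c p.1 • w p.1 p.2)
      (univ ×ˢ Icc 0 T) := (hc.comp continuous_fst).continuousOn.smul hw.continuousOn
  have h2 := h1.aestronglyMeasurable (μ := volume.prod volume)
    (MeasurableSet.univ.prod measurableSet_Icc)
  rw [← Measure.prod_restrict, Measure.restrict_univ] at h2
  exact h2.prod_swap.integral_prod_right'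

/-- The sum `‖a‖²⟨e, w⟩ + ⟨e, v⟩` has zero initial slope by Green's formula, so it is a bounded
solution of the homogeneous Volterra equation with coefficient `-‖a‖² Θ`. -/
lemma IsSolution.pairing_planeWave_laplacian_eq (hw : IsSolution T φ α Θ g w)
    (hv : IsSolution T φ α Θ (Δ g) v) (h : IsTimeChange T φ) (hα₁ : 1 < α) (hα₂ : α ≤ 2)
    (hΘ : ContinuousOn Θ (Icc 0 T)) (hg : ContDiff ℝ 2 g) (hgc : HasCompactSupport g)
    (a : EuclideanSpace ℝ (Fin n)) (θ : ℝ) {t : ℝ} (ht : t ∈ Icc 0 T) :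
    pairing (planeWave a θ) v t = -(‖a‖ ^ 2 • pairing (planeWave a θ) w t) := by
  have hgi : Integrable g := hg.continuous.integrable_of_hasCompactSupport hgc
  have hΔi : Integrable (Δ g) :=
    (continuous_laplacian hg).integrable_of_hasCompactSupport (hasCompactSupport_laplacian hgc)
  obtain ⟨M, hM0, hM⟩ := hw.norm_pairing_le
  obtain ⟨N, hN0, hN⟩ := hv.norm_pairing_le
  have hk : ContinuousOn (fun s => -‖a‖ ^ 2 * Θ s) (Icc 0 T) := continuousOn_const.mul hΘ
  have hcont := (contDiff_planeWave (n := 0) a θ).continuous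
  have hle := abs_planeWave_le_one a θ
  have hwi : IntegrableOn (fun s => (-‖a‖ ^ 2 * Θ s) • ‖a‖ ^ 2 • pairing (planeWave a θ) w s)
      (Icc 0 T) :=
    ((hw.integrableOn_pairing hcont hle).continuousOn_smul continuousOn_const
      isCompact_Icc).continuousOn_smul hk isCompact_Icc
  have hvi : IntegrableOn (fun s => (-‖a‖ ^ 2 * Θ s) • pairing (planeWave a θ) v s)
      (Icc 0 T) := (hv.integrableOn_pairing hcont hle).continuousOn_smul hk isCompact_Icc
  have hdata : ∫ x, planeWave a θ x • Δ g x = -(‖a‖ ^ 2 • ∫ x, planeWave a θ x • g x) := by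
    rw [integral_smul_laplacian (contDiff_planeWave a θ) hg hgc, ← integral_smul, ← integral_neg]
    simp only [laplacian_planeWave, mul_smul, neg_smul]
  have hzero := h.eq_zero_of_eq_rlIntegral hα₁.le hk
    (f := fun s => ‖a‖ ^ 2 • pairing (planeWave a θ) w s + pairing (planeWave a θ) v s)
    (M := ‖a‖ ^ 2 * (1 * M) + 1 * N) (fun s hs => ?_) (fun s hs => ?_) t ht
  · exact eq_neg_of_add_eq_zero_right hzero
  · refine (norm_add_le _ _).trans (add_le_add ?_ (hN _ 1 hle s hs))
    rw [norm_smul, Real.norm_of_nonneg (by positivity)]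
    exact mul_le_mul_of_nonneg_left (hM _ 1 hle s hs) (by positivity)
  · simp only [smul_add]
    rw [h.rlIntegral_add hα₁.le hwi hvi hs]
    simp only [smul_comm _ (‖a‖ ^ 2) (pairing (planeWave a θ) w _)]
    rw [rlIntegral_const_smul, hw.pairing_planeWave_eq h hα₁ hα₂ hΘ hgi a θ hs,
      hv.pairing_planeWave_eq h hα₁ hα₂ hΘ hΔi a θ hs, hdata, smul_neg, smul_add,
      smul_comm (‖a‖ ^ 2) (φ s - φ 0)]
    abel

/-- The solution with datum `Δ g` is the distributional Laplacian of the solution with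
datum `g`. -/
lemma IsSolution.pairing_laplacian_eq (hw : IsSolution T φ α Θ g w)
    (hv : IsSolution T φ α Θ (Δ g) v) (h : IsTimeChange T φ) (hα₁ : 1 < α) (hα₂ : α ≤ 2)
    (hΘ : ContinuousOn Θ (Icc 0 T)) (hg : ContDiff ℝ 2 g) (hgc : HasCompactSupport g)
    {ψ : EuclideanSpace ℝ (Fin n) → ℝ} (hψ : ContDiff ℝ ∞ ψ) (hψc : HasCompactSupport ψ)
    {t : ℝ} (ht : t ∈ Icc 0 T) :
    pairing (Δ ψ) w t = pairing ψ v t := by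
  obtain ⟨_, hwi⟩ := hw.bounded_L1
  obtain ⟨_, hvi⟩ := hv.bounded_L1
  refine integral_laplacian_smul_of_planeWave (hwi t ht).1 (hvi t ht).1 (fun a θ => ?_) hψ hψc
  rw [neg_smul]
  exact hw.pairing_planeWave_laplacian_eq hv h hα₁ hα₂ hΘ hg hgc a θ ht

/-- A normalised bump is a probability density. Small `ε` yields convergence to `f q`; the choice `z
= 0` yields a uniform bound. -/
lemma norm_integral_normed_smul_sub_le {V : Type*} [NormedAddCommGroup V] [InnerProductSpace ℝ V]
    [FiniteDimensional ℝ V] [MeasurableSpace V] [BorelSpace V] {q : V} (b : ContDiffBump q)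
    {f : V → ℂ} (hf : Continuous f) {z : ℂ} {ε : ℝ}
    (hε : ∀ x ∈ Metric.closedBall q b.rOut, ‖f x - z‖ ≤ ε) :
    ‖(∫ x, b.normed volume x • f x) - z‖ ≤ ε := by
  have hb : Integrable (b.normed volume) := b.integrable_normed
  have hc : HasCompactSupport (b.normed volume) := b.hasCompactSupport_normed
  have e : (∫ x, b.normed volume x • f x) - z = ∫ x, b.normed volume x • (f x - z) := by
    simp only [smul_sub]
    rw [integral_sub (f := fun x => b.normed volume x • f x) ((b.continuous_normed.smul hf).integrable_of_hasCompactSupport hc.smul_right)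
      (hb.smul_const z), integral_smul_const, b.integral_normed, one_smul]
  rw [e]
  refine (norm_integral_le_of_norm_le (hb.mul_const ε) (.of_forall fun x => ?_)).trans_eq ?_
  · rw [norm_smul, Real.norm_of_nonneg (b.nonneg_normed x)]
    by_cases hx : x ∈ Metric.closedBall q b.rOut
    · exact mul_le_mul_of_nonneg_left (hε x hx) (b.nonneg_normed x)
    · have : b.normed volume x = 0 := by
        by_contra hne
        have hmem : x ∈ Function.support (b.normed volume) := hne
        rw [b.support_normed_eq] at hmem
        exact hx (Metric.ball_subset_closedBall hmem)
      simp [this]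
  · rw [integral_mul_const, b.integral_normed, one_mul]

/-- The pointwise integral equation satisfied by the solution. -/
lemma IsSolution.apply_eq (hw : IsSolution T φ α Θ g w)
    (hv : IsSolution T φ α Θ (Δ g) v) (h : IsTimeChange T φ) (hα₁ : 1 < α) (hα₂ : α ≤ 2)
    (hΘ : ContinuousOn Θ (Icc 0 T)) (hg : ContDiff ℝ 2 g) (hgc : HasCompactSupport g)
    (q : EuclideanSpace ℝ (Fin n)) {t : ℝ} (ht : t ∈ Icc 0 T) :
    w q t = (φ t - φ 0) • g q + rlIntegral T φ α (fun s => Θ s • v q s) t := by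
  -- An approximate identity at `q`. All outer radii are at most `1`, so one bound for `v` on a
  -- compact set dominates every pairing.
  let b : ℕ → ContDiffBump q := fun k =>
    ⟨1 / ((k : ℝ) + 1) / 2, 1 / ((k : ℝ) + 1), by positivity, half_lt_self (by positivity)⟩
  have hb1 : ∀ k, (b k).rOut ≤ 1 := fun k => by
    change 1 / ((k : ℝ) + 1) ≤ 1
    rw [div_le_one (by positivity)]
    simp
  have hbt : Filter.Tendsto (fun k => (b k).rOut) Filter.atTop (nhds 0) :=
    tendsto_one_div_add_atTop_nhds_zero_nat
  have hlim : ∀ {f : EuclideanSpace ℝ (Fin n) → ℂ}, Continuous f → Filter.Tendsto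
      (fun k => ∫ x, (b k).normed volume x • f x) Filter.atTop (nhds (f q)) := by
    intro f hf
    rw [Metric.tendsto_nhds]
    intro ε hε
    obtain ⟨δ, hδ, hfδ⟩ := Metric.continuousAt_iff.1 hf.continuousAt (ε / 2) (half_pos hε)
    filter_upwards [hbt.eventually_lt_const hδ] with k hk
    rw [dist_eq_norm]
    refine (norm_integral_normed_smul_sub_le (b k) hf (ε := ε / 2) fun x hx => ?_).trans_lt
      (half_lt_self hε)
    rw [← dist_eq_norm]
    exact (hfδ ((Metric.mem_closedBall.1 hx).trans_lt hk)).le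
  have hψ : ∀ k, ContDiff ℝ ∞ ((b k).normed volume) := fun k => (b k).contDiff_normed
  have hψc : ∀ k, HasCompactSupport ((b k).normed volume) :=
    fun k => (b k).hasCompactSupport_normed
  obtain ⟨N, hN⟩ := ((isCompact_closedBall q 1).prod
    (isCompact_Icc (a := (0 : ℝ)) (b := T))).exists_bound_of_continuousOn
      (hv.continuousOn.mono (prod_mono_left (subset_univ _)))
  obtain ⟨C, hC⟩ := isCompact_Icc.exists_bound_of_continuousOn hΘ
  have l3 := h.tendsto_rlIntegral (F := fun k s => Θ s • pairing ((b k).normed volume) v s)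
    (f := fun s => Θ s • v q s) (B := C * N) hα₁.le
    (fun k => hΘ.smul (hv.contDiffOn _ (hψ k) (hψc k)).continuousOn)
    (fun k s hs => ?_) (fun s hs => (hlim (hv.continuous hs)).const_smul _) ht
  · refine tendsto_nhds_unique (hlim (hw.continuous ht))
      ((((hlim hg.continuous).const_smul (φ t - φ 0)).add l3).congr fun k => ?_)
    refine Eq.trans ?_ (hw.pairing_eq h hα₁ hα₂ hΘ (hψ k) (hψc k) ht).symm
    congr 1
    refine rlIntegral_congr (fun s hs => ?_) ht
    simp only [hw.pairing_laplacian_eq hv h hα₁ hα₂ hΘ hg hgc (hψ k) (hψc k) hs]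
  · rw [norm_smul]
    refine mul_le_mul (hC s hs) ?_ (norm_nonneg _) ((norm_nonneg _).trans (hC s hs))
    have := norm_integral_normed_smul_sub_le (b k) (hv.continuous hs) (z := 0) (ε := N)
      fun x hx => by
        rw [sub_zero]
        exact hN (x, s) ⟨Metric.closedBall_subset_closedBall (hb1 k) hx, hs⟩
    rw [sub_zero] at this
    exact this

end

end FractionalWave

/-! ### Recovery of the coefficient -/

theorem mainTheorem5 {n : ℕ} (α T : ℝ) (hα₁ : 1 < α) (hα₂ : α ≤ 2) (hT : 0 < T)
    (φ : ℝ → ℝ) (hφ : ContDiffOn ℝ 1 φ (Icc 0 T))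
    (hφ' : ∀ t ∈ Icc 0 T, 0 < derivWithin φ (Icc 0 T) t)
    (Θ : ℝ → ℝ) (hΘ : ContinuousOn Θ (Icc 0 T)) (hΘ_pos : ∀ t ∈ Icc 0 T, 0 < Θ t)
    (hsmall : ∃ ν > 0, ∃ C, 0 < C ∧ C < 1 ∧ ∀ t ∈ Icc 0 T,
      sSup ((fun s => |Θ s|) '' Icc 0 T) *
          FractionalWave.rlIntegral T φ α (fun s => Real.exp (ν * s)) t
        ≤ C * Real.exp (ν * t))
    (Ω : Set (EuclideanSpace ℝ (Fin n))) (hΩ : IsOpen Ω) (hΩ_bdd : Bornology.IsBounded Ω)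
    (w₁ : EuclideanSpace ℝ (Fin n) → ℂ)
    (hw₁ : ContDiffOn ℝ 2 w₁ Ω) (hw₁' : ContDiffOn ℝ 1 w₁ (closure Ω))
    (hw₁_supp : tsupport w₁ ⊆ Ω)
    (q : EuclideanSpace ℝ (Fin n)) (hq : q ∈ Ω)
    (w v : EuclideanSpace ℝ (Fin n) → ℝ → ℂ)
    (hw : FractionalWave.IsSolution T φ α Θ w₁ w)
    (hv : FractionalWave.IsSolution T φ α Θ (Δ w₁) v)
    (h₁ h₂ : ℝ → ℂ)
    (hh₁ : ∀ t ∈ Icc 0 T, h₁ t = w q t - (φ t - φ 0) • w₁ q)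
    (hh₂ : ∀ t ∈ Icc 0 T, h₂ t = v q t)
    (hh₂_smooth : ContDiffOn ℝ 2 h₂ (Icc 0 T)) (hh₂_ne : ∀ t ∈ Ioo 0 T, h₂ t ≠ 0)
    (K : ℝ) (hK : 0 < K)
    (hratio : ∀ t ∈ Ioc 0 T, (K : ℂ) ≤ FractionalWave.rlDeriv T φ α h₁ t / h₂ t) :
    FractionalWave.RLDifferentiable T φ α h₁ ∧
      ∀ t ∈ Ioc 0 T, (Θ t : ℂ) = FractionalWave.rlDeriv T φ α h₁ t / h₂ t := by
  have h : FractionalWave.IsTimeChange T φ := ⟨hT, hφ, hφ'⟩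
  have hg : ContDiff ℝ 2 w₁ :=
    FractionalWave.contDiff_of_contDiffOn_of_tsupport_subset hΩ hw₁ hw₁_supp
  have hgc : HasCompactSupport w₁ :=
    Metric.isCompact_of_isClosed_isBounded (isClosed_tsupport w₁) (hΩ_bdd.subset hw₁_supp)
  -- Subtracting `(φ t - φ 0) • w₁ q` removes exactly the free term of the integral equation at `q`.
  have hrep : ∀ t ∈ Icc 0 T, h₁ t = FractionalWave.rlIntegral T φ α (fun s => Θ s • h₂ s) t := by
    intro t ht
    rw [hh₁ t ht, hw.apply_eq hv h hα₁ hα₂ hΘ hg hgc q ht, add_sub_cancel_left]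
    exact FractionalWave.rlIntegral_congr (fun s hs => by simp only [hh₂ s hs]) ht
  obtain ⟨hd, he⟩ := h.rlDifferentiable_and_rlDeriv_eq hα₁ hα₂
    (hΘ.smul hh₂_smooth.continuousOn) hrep
  refine ⟨hd, fun t ht => ?_⟩
  -- Since `x / 0 = 0`, a zero of `h₂` would force `K ≤ 0`; this also covers `t = T`.
  have hne : h₂ t ≠ 0 := by
    intro h0
    have hle := hratio t ht
    rw [h0, div_zero] at hle
    exact hK.not_ge (by exact_mod_cast hle)
  rw [he t (Ioc_subset_Icc_self ht), Pi.smul_apply', Complex.real_smul, mul_div_cancel_right₀ _ hne]
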